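/- Let $k$ be a field, let $S=k[x_1,\dots,x_N]$ with its standard grading, and let $\mathfrak m=(x_1,\dots,x_N)$. For a finitely generated graded $S$-module $M$ put $a^i(M)=\max\{t\in\mathbb Z : [H^i_{\mathfrak m}(M)]_t\neq 0\}$, with $a^i(M)=-\infty$ if $H^i_{\mathfrak m}(M)=0$, where $H^i_{\mathfrak m}$ denotes graded local cohomology, and let $\mathrm{reg}(M)=\max_{i\ge 0}\{a^i(M)+i\}$ be the Castelnuovo–Mumford regularity of $M$. Let $I\subseteq S$ be a complete intersection, that is, an ideal generated by a regular sequence of $S$, and suppose that $I$ is a nonzero monomial ideal with minimal set of monomial generators $\{u_1,\dots,u_s\}$, $s\ge 1$, numbered so that $\deg u_1\ge\dots\ge\deg u_s$. Then for every $n\ge 1$, $$\mathrm{reg}(I^n)=n\deg(u_1)+\sum_{j=2}^{s}\deg(u_j)-(s-1).$$ -/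

import Mathlib

noncomputable section

namespace CMReg

open MvPolynomial

section Graded

variable {k : Type*} [Field k] {N : ℕ}

/-- The squarefree monomial `x_F = ∏_{j ∈ F} x_j` of `k[x_0, …, x_{N-1}]`. -/
def varProd (k : Type*) [Field k] {N : ℕ} (F : Finset (Fin N)) : MvPolynomial (Fin N) k :=
  ∏ j ∈ F, X j

variable (M : Type*) [AddCommGroup M] [Module (MvPolynomial (Fin N) k) M]

/-- The localization `M_{x_F}` of a module `M` over `S = k[x_0, …, x_{N-1}]`. -/
abbrev Loc (F : Finset (Fin N)) : Type _ :=
  LocalizedModule (Submonoid.powers (varProd k F)) M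

variable (k) in
lemma isUnit_powers_of_subset {F G : Finset (Fin N)} (h : F ⊆ G)
    (x : Submonoid.powers (varProd k F)) :
    IsUnit (algebraMap (MvPolynomial (Fin N) k)
      (Module.End (MvPolynomial (Fin N) k) (Loc (k := k) M G)) x) := by
  obtain ⟨_, n, rfl⟩ := x
  have hG : IsUnit (algebraMap (MvPolynomial (Fin N) k)
      (Module.End (MvPolynomial (Fin N) k) (Loc (k := k) M G)) (varProd k G)) :=
    IsLocalizedModule.map_units (LocalizedModule.mkLinearMap _ M)
      (⟨varProd k G, Submonoid.mem_powers _⟩ : Submonoid.powers (varProd k G))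
  have hdvd : varProd k F ∣ varProd k G := Finset.prod_dvd_prod_of_subset _ _ _ h
  obtain ⟨q, hq⟩ := hdvd
  have hF : IsUnit (algebraMap (MvPolynomial (Fin N) k)
      (Module.End (MvPolynomial (Fin N) k) (Loc (k := k) M G)) (varProd k F)) := by
    have e := congrArg (algebraMap (MvPolynomial (Fin N) k)
      (Module.End (MvPolynomial (Fin N) k) (Loc (k := k) M G))) hq
    rw [map_mul] at e
    have hc : Commute _ _ := Algebra.commutes (varProd k F) (algebraMap (MvPolynomial (Fin N) k)
      (Module.End (MvPolynomial (Fin N) k) (Loc (k := k) M G)) q)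
    exact (hc.isUnit_mul_iff.mp (e ▸ hG)).1
  simpa using hF.pow n

/-- The canonical map `M_{x_F} → M_{x_G}`, `m / x_F ^ a ↦ m / x_F ^ a`, for `F ⊆ G`. -/
def locRes {F G : Finset (Fin N)} (h : F ⊆ G) :
    Loc (k := k) M F →ₗ[MvPolynomial (Fin N) k] Loc (k := k) M G :=
  LocalizedModule.lift _ (LocalizedModule.mkLinearMap _ M) (isUnit_powers_of_subset k M h)

/-- All Čech cochains of `M` with respect to the variables: families `(c_F)_F` with
`c_F ∈ M_{x_F}`. -/
abbrev Cochain (k : Type*) [Field k] {N : ℕ} (M : Type*) [AddCommGroup M]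
    [Module (MvPolynomial (Fin N) k) M] : Type _ :=
  (F : Finset (Fin N)) → Loc (k := k) M F

/-- The Čech differential
`(d c)_G = ∑_{j ∈ G} (-1) ^ #{i ∈ G | i < j} • (c_{G \ {j}} regarded in M_{x_G})`. -/
def cechD : Cochain k (N := N) M →ₗ[MvPolynomial (Fin N) k] Cochain k (N := N) M :=
  LinearMap.pi fun G => ∑ j ∈ G,
    ((-1 : MvPolynomial (Fin N) k) ^ (G.filter (· < j)).card) •
      (locRes (k := k) M (G.erase_subset j) ∘ₗ
        LinearMap.proj (φ := fun F : Finset (Fin N) => Loc (k := k) M F) (G.erase j))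

lemma locRes_mk {F G : Finset (Fin N)} (h : F ⊆ G) (m : M) :
   locRes (k := k) M h (LocalizedModule.mk m 1) = LocalizedModule.mk m 1 := by
  have := LocalizedModule.lift_comp (Submonoid.powers (varProd k F))
    (LocalizedModule.mkLinearMap (Submonoid.powers (varProd k G)) M)
    (isUnit_powers_of_subset k M h)
  exact congrArg (fun f => f m) this

lemma locRes_comp {F G H : Finset (Fin N)} (h : F ⊆ G) (h' : G ⊆ H) (z) :
   locRes (k := k) M h' (locRes (k := k) M h z) = locRes (k := k) M (h.trans h') z := by
  have : (locRes (k := k) M h') ∘ₗ (locRes (k := k) M h) = locRes (k := k) M (h.trans h') := by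
    apply IsLocalizedModule.ext (Submonoid.powers (varProd k F))
      (LocalizedModule.mkLinearMap _ M) (isUnit_powers_of_subset k M (h.trans h'))
    ext m
    simp [LocalizedModule.mkLinearMap_apply, locRes_mk]
  exact congrArg (fun f => f z) this

lemma locRes_congr (c : Cochain k (N := N) M) {F F' G : Finset (Fin N)} (e : F = F') (h : F ⊆ G) (h' : F' ⊆ G) :
  locRes M h (c F) = locRes M h' (c F') := by subst e; rfl

lemma cechD_apply (c : Cochain k (N := N) M) (G : Finset (Fin N)) :
    cechD M c G = ∑ j ∈ G, ((-1 : MvPolynomial (Fin N) k) ^ (G.filter (· < j)).card) •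
      (locRes (k := k) M (G.erase_subset j) (c (G.erase j))) := by
  simp [cechD, LinearMap.sum_apply]

/-- The Čech differential squares to zero. -/
lemma cechD_cechD (c : Cochain k (N := N) M) : cechD M (cechD M c) = 0 := by
  funext G
  rw [cechD_apply]
  simp only [cechD_apply, map_sum, map_smul, locRes_comp, Finset.smul_sum, smul_smul]
  rw [Finset.sum_sigma']
  refine Finset.sum_involution (fun x _ => ⟨x.2, x.1⟩) ?_ ?_ ?_ ?_
  · rintro ⟨a, b⟩ hab
    simp only [Finset.mem_sigma, Finset.mem_erase] at hab
    obtain ⟨ha, hba, hb⟩ := hab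
    dsimp only
    rw [locRes_congr M c (Finset.erase_right_comm (s := G) (a := b) (b := a)) _
      (((G.erase a).erase_subset b).trans (G.erase_subset a)), ← add_smul]
    convert zero_smul (MvPolynomial (Fin N) k) _
    have key : ∀ x y : Fin N, x ∈ G → x < y →
        ((G.erase x).filter (· < y)).card + 1 = (G.filter (· < y)).card ∧
        ((G.erase y).filter (· < x)).card = (G.filter (· < x)).card := by
      intro x y hx hxy
      constructor
      · rw [Finset.filter_erase, Finset.card_erase_add_one]; simp [hx, hxy]
      · rw [Finset.filter_erase, Finset.erase_eq_of_notMem]; simp [hxy.le]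
    rcases lt_or_gt_of_ne hba with h | h
    · obtain ⟨h1, h2⟩ := key b a hb h
      rw [← h1, h2]; ring
    · obtain ⟨h1, h2⟩ := key a b ha h
      rw [← h1, h2]; ring
  · rintro ⟨a, b⟩ hab _ h
    simp only [Finset.mem_sigma, Finset.mem_erase] at hab
    simp at h; exact hab.2.1 h.1
  · rintro ⟨a, b⟩ hab
    simp only [Finset.mem_sigma, Finset.mem_erase] at hab ⊢
    exact ⟨hab.2.2, fun h => hab.2.1 h.symm, hab.1⟩
  · intros; rfl

variable {M}
variable (𝓜 : ℤ → AddSubgroup M)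

/-- For a graded module `M = ⨁_t 𝓜 t`, the degree `t` part of the graded module `M_{x_F}`:
it consists of the fractions `m / x_F ^ a` with `m` homogeneous of degree
`t + deg (x_F ^ a) = t + a * #F`. -/
def locDeg (F : Finset (Fin N)) (t : ℤ) : AddSubgroup (Loc (k := k) M F) :=
  AddSubgroup.closure {z | ∃ (a : ℕ) (m : M), m ∈ 𝓜 (t + a * F.card) ∧
    z = LocalizedModule.mk m (⟨varProd k F ^ a, a, rfl⟩ : Submonoid.powers (varProd k F))}

variable (k) in
/-- `C^p(M)_t`: the degree `t` part of the `p`-th term `⨁_{#F = p} M_{x_F}` of the Čech complex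
(zero for `p < 0`). -/
def cochains (p : ℤ) (t : ℤ) : AddSubgroup (Cochain k (N := N) M) where
  carrier := {c | ∀ F, c F ∈ locDeg 𝓜 F t ∧ ((F.card : ℤ) ≠ p → c F = 0)}
  zero_mem' F := ⟨zero_mem _, fun _ => rfl⟩
  add_mem' {c d} hc hd F := ⟨add_mem (hc F).1 (hd F).1, fun h => by
    rw [Pi.add_apply, (hc F).2 h, (hd F).2 h, add_zero]⟩
  neg_mem' {c} hc F := ⟨neg_mem (hc F).1, fun h => by
    rw [Pi.neg_apply, (hc F).2 h, neg_zero]⟩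

variable (k) in
/-- `Z^p(M)_t`: the cocycles in `C^p(M)_t`. -/
def cocycles (p : ℤ) (t : ℤ) : AddSubgroup (Cochain k (N := N) M) :=
  cochains k 𝓜 p t ⊓ (cechD (k := k) M).toAddMonoidHom.ker

variable (k) in
/-- `B^p(M)_t`: the image of `C^{p-1}(M)_t` under the Čech differential. -/
def coboundaries (p : ℤ) (t : ℤ) : AddSubgroup (Cochain k (N := N) M) :=
  (cochains k 𝓜 (p - 1) t).map (cechD (k := k) M).toAddMonoidHom

variable (k) in
/-- `[H^i_𝔪(M)]_t`: the degree `t` part of the `i`-th local cohomology of the graded module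
`M = ⨁_t 𝓜 t` over `S = k[x_0, …, x_{N-1}]` with support in `𝔪 = (x_0, …, x_{N-1})`, as the
cohomology of the degree `t` part of the Čech complex
`0 → M → ⨁_j M_{x_j} → ⨁_{j < l} M_{x_j x_l} → ⋯ → M_{x_0 ⋯ x_{N-1}} → 0`. -/
abbrev LocalCohomologyDeg (i : ℕ) (t : ℤ) : Type _ :=
  cocycles (N := N) k 𝓜 i t ⧸
    (coboundaries (N := N) k 𝓜 i t).addSubgroupOf (cocycles (N := N) k 𝓜 i t)

variable (k N) in
/-- `a^i(M) = max {t | [H^i_𝔪(M)]_t ≠ 0}`, with value `⊥ = -∞` if `H^i_𝔪(M) = 0`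
(and `⊤` if the degrees are unbounded above). -/
def aInv (i : ℕ) : WithBot (WithTop ℤ) :=
  sSup {a | ∃ t : ℤ, Nontrivial (LocalCohomologyDeg (N := N) k 𝓜 i t) ∧
    a = ((t : WithTop ℤ) : WithBot (WithTop ℤ))}

variable (k N) in
/-- The Castelnuovo-Mumford regularity `reg(M) = max_{i ≥ 0} (a^i(M) + i)` of the graded module
`M = ⨁_t 𝓜 t` over `k[x_0, …, x_{N-1}]`. -/
def reg : WithBot (WithTop ℤ) :=
  ⨆ i : ℕ, aInv k N 𝓜 i + (((i : ℤ) : WithTop ℤ) : WithBot (WithTop ℤ))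

end Graded

section Ideals

variable {k : Type*} [Field k] {N : ℕ}

/-- The standard grading on an ideal `I` of `k[x_0, …, x_{N-1}]`: in degree `t ∈ ℤ` it consists
of the elements of `I` all of whose monomials have total degree `t`. -/
def idealGrading (I : Ideal (MvPolynomial (Fin N) k)) (t : ℤ) : AddSubgroup I where
  carrier := {f | ∀ e : Fin N →₀ ℕ, coeff e (f : MvPolynomial (Fin N) k) ≠ 0 →
    (e.degree : ℤ) = t}
  zero_mem' e h := absurd (by simp) h
  add_mem' {f g} hf hg e h := by
    by_cases h1 : coeff e (f : MvPolynomial (Fin N) k) = 0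
    · by_cases h2 : coeff e (g : MvPolynomial (Fin N) k) = 0
      · exact absurd (by simp [h1, h2]) h
      · exact hg e h2
    · exact hf e h1
  neg_mem' {f} hf e h := hf e (by simpa using h)

/-- The Castelnuovo-Mumford regularity of a homogeneous ideal, as a graded module. -/
def idealReg (I : Ideal (MvPolynomial (Fin N) k)) : WithBot (WithTop ℤ) :=
  reg k N (idealGrading I)

/-- `I` is a complete intersection: it is generated by a regular sequence. -/
def IsCompleteIntersection (I : Ideal (MvPolynomial (Fin N) k)) : Prop :=
  ∃ rs : List (MvPolynomial (Fin N) k),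
    RingTheory.Sequence.IsRegular (MvPolynomial (Fin N) k) rs ∧ Ideal.ofList rs = I

/-- `u_0, …, u_{s-1}` are monomials which generate `I`, and none of them is redundant
(in particular they are distinct). -/
structure IsMinimalMonomialGenerators {s : ℕ} (u : Fin s → MvPolynomial (Fin N) k)
    (I : Ideal (MvPolynomial (Fin N) k)) : Prop where
  monomial : ∀ i, ∃ e : Fin N →₀ ℕ, u i = MvPolynomial.monomial e 1
  span_eq : Ideal.span (Set.range u) = I
  irredundant : ∀ i, u i ∉ Ideal.span (u '' {j | j ≠ i})

end Ideals

end CMReg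

end

/-! Local cohomology of a monomial ideal is multigraded: in multidegree `a` the Čech complex becomes
the simplicial cochain complex on the sets `F` with `x^a` in the localization at `x_F`, an up-set of
subsets of `Fin N`. Everything reduces to the cohomology of such up-sets for `I ^ n`.

The minimal monomial generators `x^{e_j}` of a monomial complete intersection have pairwise disjoint
supports (`IsCompleteIntersection.disjoint_support`): a common variable would give a relation with
coefficients outside `I`, whereas relations among generators of a regular sequence have coefficients
in `I`.

Let `a` be a multidegree. If some coordinate with `a y ≥ 0` lies in no support, or some support is
entirely negative while another coordinate is nonnegative, the up-set is a cone and contributes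
nothing. Otherwise pick in each support a point `y_j` maximizing `⌊a x / e_j x⌋`, with maximum
`w_j`, and let `T` be the set of these `s` points. Cochains can be moved onto sets containing `Tᶜ`.
All strict supersets of `Tᶜ` belong to the up-set, and `Tᶜ` itself does exactly when `∑ w_j ≥ n`. So
cohomology survives only if `∑ w_j ≤ n - 1`, and then in degree `N - s + 1`. There `a i + 1 ≤ (w_j +
1) e_j i` on each support, whence `|a| + N ≤ ∑ (w_j + 1) deg u_j`; this is largest when all the
weight `n - 1` sits on a generator of top degree, which gives the upper bound
(`exists_coboundaryMap_eq_of_lt`). Equality throughout defines a multidegree in which the bound is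
attained (`exists_cocycle_not_coboundary`). -/

/-! ### Simplicial cochains on up-sets of subsets of `Fin N`. -/

section UpSetCohomology

variable {k : Type*} [CommRing k] {N : ℕ}

/-- The sign `(-1) ^ #{i ∈ F | i < j}`. -/
def insertSign (k : Type*) [CommRing k] {N : ℕ} (j : Fin N) (F : Finset (Fin N)) : k :=
  (-1) ^ (F.filter (· < j)).card

/-- The simplicial coboundary of a function on the subsets of `Fin N`. -/
def coboundaryMap (c : Finset (Fin N) → k) (G : Finset (Fin N)) : k :=
  ∑ j ∈ G, insertSign k j G * c (G.erase j)

/-- The contracting homotopy of the cone with apex `y`. -/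
def coneHomotopy (y : Fin N) (c : Finset (Fin N) → k) (F : Finset (Fin N)) : k :=
  if y ∈ F then 0 else insertSign k y F * c (insert y F)

lemma insertSign_mul_self (j : Fin N) (F : Finset (Fin N)) :
    insertSign k j F * insertSign k j F = 1 := by
  rw [insertSign, ← pow_add, ← two_mul, pow_mul]; simp

lemma insertSign_insert_of_lt {x y : Fin N} {F : Finset (Fin N)} (hx : x ∉ F) (h : x < y) :
    insertSign k y (insert x F) = -insertSign k y F := by
  rw [insertSign, Finset.filter_insert, if_pos h, Finset.card_insert_of_notMem (by simp [hx]),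
    pow_succ, insertSign]
  ring

lemma insertSign_insert_of_le {x y : Fin N} {F : Finset (Fin N)} (h : y ≤ x) :
    insertSign k y (insert x F) = insertSign k y F := by
  rw [insertSign, Finset.filter_insert, if_neg (not_lt.mpr h), insertSign]

/-- Inserting two elements in either order differs by a sign; this drives both `d ∘ d = 0` and the
cone homotopy. -/
lemma insertSign_exchange {x y : Fin N} {F : Finset (Fin N)} (hxy : x ≠ y) (hx : x ∉ F)
    (hy : y ∉ F) :
    insertSign k x (insert y F) * insertSign k y F
      = -(insertSign k y (insert x F) * insertSign k x F) := by
  rcases lt_or_gt_of_ne hxy with h | h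
  · rw [insertSign_insert_of_le h.le, insertSign_insert_of_lt hx h]; ring
  · rw [insertSign_insert_of_le h.le, insertSign_insert_of_lt hy h]; ring

lemma coboundaryMap_coboundaryMap (c : Finset (Fin N) → k) (G : Finset (Fin N)) :
    coboundaryMap (coboundaryMap c) G = 0 := by
  simp only [coboundaryMap, Finset.mul_sum]
  rw [Finset.sum_sigma']
  refine Finset.sum_involution (fun x _ => ⟨x.2, x.1⟩) ?_ ?_ ?_ ?_
  · rintro ⟨a, b⟩ hab
    simp only [Finset.mem_sigma, Finset.mem_erase] at hab
    obtain ⟨ha, hba, hb⟩ := hab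
    dsimp only
    rw [Finset.erase_right_comm (s := G) (a := b) (b := a), ← mul_assoc, ← mul_assoc, ← add_mul]
    have e := insertSign_exchange (k := k) (x := a) (y := b) (F := (G.erase a).erase b)
      hba.symm (by simp) (by simp)
    rw [Finset.insert_erase (by simp [hb, hba]), Finset.erase_right_comm,
      Finset.insert_erase (by simp [ha, hba.symm])] at e
    have e2 : insertSign k a G = (if b < a then -1 else 1) * insertSign k a (G.erase b) := by
      conv_lhs => rw [← Finset.insert_erase hb]
      split_ifs with h
      · rw [insertSign_insert_of_lt (by simp) h]; ring
      · rw [insertSign_insert_of_le (not_lt.mp h)]; ring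
    have e3 : insertSign k b G = (if a < b then -1 else 1) * insertSign k b (G.erase a) := by
      conv_lhs => rw [← Finset.insert_erase ha]
      split_ifs with h
      · rw [insertSign_insert_of_lt (by simp) h]; ring
      · rw [insertSign_insert_of_le (not_lt.mp h)]; ring
    rw [e2, e3]
    rcases lt_or_gt_of_ne hba with h | h
    · rw [if_pos h, if_neg h.not_gt]; ring
    · rw [if_pos h, if_neg h.not_gt]; ring
  · rintro ⟨a, b⟩ hab _ h
    simp only [Finset.mem_sigma, Finset.mem_erase] at hab
    simp at h; exact hab.2.1 h.1
  · rintro ⟨a, b⟩ hab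
    simp only [Finset.mem_sigma, Finset.mem_erase] at hab ⊢
    exact ⟨hab.2.2, fun h => hab.2.1 h.symm, hab.1⟩
  · intros; rfl

lemma coboundaryMap_add (c c' : Finset (Fin N) → k) :
    coboundaryMap (c + c') = coboundaryMap c + coboundaryMap c' := by
  funext G
  simp [coboundaryMap, mul_add, Finset.sum_add_distrib]

lemma coboundaryMap_sub (c c' : Finset (Fin N) → k) :
    coboundaryMap (c - c') = coboundaryMap c - coboundaryMap c' := by
  funext G
  simp [coboundaryMap, mul_sub, Finset.sum_sub_distrib]

lemma coboundaryMap_zero : coboundaryMap (0 : Finset (Fin N) → k) = 0 := by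
  funext G
  simp [coboundaryMap]

/-- The cone over `y` is contractible. -/
lemma coboundaryMap_coneHomotopy (y : Fin N) (c : Finset (Fin N) → k) (F : Finset (Fin N)) :
    coboundaryMap (coneHomotopy y c) F + coneHomotopy y (coboundaryMap c) F = c F := by
  by_cases hy : y ∈ F
  · rw [coneHomotopy, if_pos hy, add_zero, coboundaryMap, Finset.sum_eq_single_of_mem y hy]
    · rw [coneHomotopy, if_neg (by simp), Finset.insert_erase hy, ← mul_assoc]
      conv_lhs => rw [← Finset.insert_erase hy]
      rw [insertSign_insert_of_le le_rfl, Finset.erase_insert (by simp),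
        insertSign_mul_self, one_mul, Finset.insert_erase hy]
    · intro j _ hj
      rw [coneHomotopy, if_pos (by simp [hy, hj.symm]), mul_zero]
  -- For `y ∉ F` the term `j = y` of the second summand is `c F`; all the others cancel pairwise by
  -- the exchange of signs.
  · rw [coneHomotopy, if_neg hy, coboundaryMap, coboundaryMap, Finset.sum_insert hy, mul_add,
      Finset.erase_insert hy, insertSign_insert_of_le le_rfl, ← mul_assoc, insertSign_mul_self,
      one_mul, add_left_comm, Finset.mul_sum, ← Finset.sum_add_distrib, Finset.sum_eq_zero,
      add_zero]
    intro j hj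
    have hjy : j ≠ y := fun h => hy (h ▸ hj)
    rw [coneHomotopy, if_neg (by simp [hy]), Finset.erase_insert_of_ne hjy.symm]
    have e := insertSign_exchange (k := k) (x := j) (y := y) (F := F.erase j) hjy (by simp)
      (by simp [hy])
    rw [Finset.insert_erase hj] at e
    have e2 : insertSign k j (insert y (F.erase j)) = insertSign k j (insert y F) := by
      rw [← Finset.erase_insert_of_ne hjy.symm]
      conv_rhs => rw [← Finset.insert_erase (Finset.mem_insert_of_mem (b := y) hj)]
      rw [insertSign_insert_of_le le_rfl]
    have e3 : insertSign k j F = insertSign k j (F.erase j) := by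
      conv_lhs => rw [← Finset.insert_erase hj]
      rw [insertSign_insert_of_le le_rfl]
    rw [e2] at e
    have s1 := insertSign_mul_self (k := k) y F
    have s2 := insertSign_mul_self (k := k) y (F.erase j)
    rw [e3]
    linear_combination (c (insert y (F.erase j))) * insertSign k y F * insertSign k y (F.erase j)
      * e + (-(insertSign k y F) * insertSign k j (insert y F) * c (insert y (F.erase j))) * s2
      + (-(insertSign k y (F.erase j)) * insertSign k j (F.erase j)
        * c (insert y (F.erase j))) * s1

/-- A cocycle supported on a family of sets which is a cone over `y` is a coboundary. -/
lemma exists_coboundaryMap_eq_of_cone {P Q : Finset (Fin N) → Prop} (y : Fin N)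
    (hPQ : ∀ F, y ∉ F → P (insert y F) → Q F) {c : Finset (Fin N) → k}
    (hc : ∀ F, c F ≠ 0 → P F) (hdc : coboundaryMap c = 0) :
    ∃ e : Finset (Fin N) → k, (∀ F, e F ≠ 0 → Q F) ∧ coboundaryMap e = c := by
  refine ⟨coneHomotopy y c, fun F hF => ?_, ?_⟩
  · unfold coneHomotopy at hF
    split_ifs at hF with h
    · exact absurd rfl hF
    · exact hPQ F h (hc _ (right_ne_zero_of_mul hF))
  · funext F
    have h := coboundaryMap_coneHomotopy y c F
    rw [hdc] at h
    simpa [coneHomotopy] using h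

/-- If the members of `P` not containing `x` form a cone over `y`, a cochain whose coboundary
lives on sets containing `x` can be moved to one which lives on sets containing `x`. -/
lemma exists_sub_coboundaryMap_supported {P Q : Finset (Fin N) → Prop} {x y : Fin N}
    (hxy : x ≠ y) (hPQ : ∀ F, x ∉ F → y ∉ F → P (insert y F) → Q F)
    {b : Finset (Fin N) → k} (hb : ∀ F, b F ≠ 0 → P F)
    (hdb : ∀ F, coboundaryMap b F ≠ 0 → x ∈ F) :
    ∃ e : Finset (Fin N) → k, (∀ F, e F ≠ 0 → Q F) ∧
      ∀ F, (b - coboundaryMap e) F ≠ 0 → x ∈ F := by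
  -- The sets avoiding `x` are closed under taking faces, so truncating `b` to them does not change
  -- its coboundary there.
  set b₀ : Finset (Fin N) → k := fun F => if x ∈ F then 0 else b F with hb₀
  have hd : ∀ F, x ∉ F → coboundaryMap b₀ F = coboundaryMap b F := by
    intro F hx
    refine Finset.sum_congr rfl fun j _ => ?_
    rw [hb₀]
    simp [hx]
  refine ⟨coneHomotopy y b₀, fun F hF => ?_, fun F => ?_⟩
  · unfold coneHomotopy at hF
    split_ifs at hF with h
    · exact absurd rfl hF
    · have h1 := right_ne_zero_of_mul hF
      simp only [hb₀] at h1
      split_ifs at h1 with h2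
      · exact absurd rfl h1
      · exact hPQ F (fun h3 => h2 (Finset.mem_insert_of_mem h3)) h (hb _ h1)
  · contrapose!
    intro hx
    have h := coboundaryMap_coneHomotopy y b₀ F
    -- `insert y F` still avoids `x`, where the coboundary of `b` vanishes; hence `b₀` is the
    -- coboundary of its cone homotopy on sets avoiding `x`.
    have h0 : coneHomotopy y (coboundaryMap b₀) F = 0 := by
      unfold coneHomotopy
      split_ifs with hy
      · rfl
      · have hx' : x ∉ insert y F := by simp [hx, hxy]
        rw [hd _ hx']
        by_contra h1
        exact hx' (hdb _ (right_ne_zero_of_mul h1))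
    rw [h0, add_zero] at h
    rw [Pi.sub_apply, h]
    simp [hb₀, hx]

lemma coboundaryMap_supported {P : Finset (Fin N) → Prop} (hP : ∀ F G, F ⊆ G → P F → P G)
    {p : ℤ} {e : Finset (Fin N) → k} (he : ∀ F, e F ≠ 0 → P F ∧ (F.card : ℤ) = p - 1)
    {F : Finset (Fin N)} (hF : coboundaryMap e F ≠ 0) : P F ∧ (F.card : ℤ) = p := by
  obtain ⟨j, hj, h⟩ := Finset.exists_ne_zero_of_sum_ne_zero hF
  obtain ⟨h1, h2⟩ := he _ (right_ne_zero_of_mul h)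
  refine ⟨hP _ _ (F.erase_subset j) h1, ?_⟩
  have := Finset.card_erase_add_one hj
  omega

/-- Successive reduction to the sets containing the complement of `T`. -/
lemma exists_sub_coboundaryMap_supported_compl {P : Finset (Fin N) → Prop}
    (hP : ∀ F G, F ⊆ G → P F → P G) (T : Finset (Fin N)) (p : ℤ) :
    ∀ (m : ℕ) (B : Finset (Fin N)), Disjoint B T → (Bᶜ).card = m →
      (∀ x ∉ B, x ∉ T → ∃ y ∈ T, ∀ F, x ∉ F → y ∉ F → P (insert y F) → P F) →
      ∀ b : Finset (Fin N) → k, (∀ F, b F ≠ 0 → (P F ∧ B ⊆ F) ∧ (F.card : ℤ) = p) →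
      (∀ F, coboundaryMap b F ≠ 0 → Tᶜ ⊆ F) →
      ∃ e : Finset (Fin N) → k, (∀ F, e F ≠ 0 → P F ∧ (F.card : ℤ) = p - 1) ∧
        ∀ F, (b - coboundaryMap e) F ≠ 0 → (P F ∧ Tᶜ ⊆ F) ∧ (F.card : ℤ) = p := by
  intro m
  induction m with
  | zero =>
    intro B hBT hm _ b hb _
    have hB : B = Finset.univ := by simpa using Finset.card_eq_zero.mp hm
    refine ⟨0, by simp, fun F hF => ?_⟩
    rw [coboundaryMap_zero, sub_zero] at hF
    obtain ⟨⟨h1, h2⟩, h3⟩ := hb F hF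
    exact ⟨⟨h1, fun i _ => h2 (by simp [hB])⟩, h3⟩
  | succ m ih =>
    intro B hBT hm hx b hb hdb
    by_cases hex : ∃ x, x ∉ B ∧ x ∉ T
    · obtain ⟨x, hxB, hxT⟩ := hex
      obtain ⟨y, hyT, hy⟩ := hx x hxB hxT
      have hyB : y ∉ B := fun h => (Finset.disjoint_left.mp hBT h) hyT
      have hxy : x ≠ y := fun h => hxT (h ▸ hyT)
      -- The condition `B ⊆ F` is carried along, so that elements already forced into the support
      -- stay there; the next round uses `insert x B`.
      obtain ⟨e₁, he₁, hbe₁⟩ := exists_sub_coboundaryMap_supported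
        (P := fun F => (P F ∧ B ⊆ F) ∧ (F.card : ℤ) = p)
        (Q := fun F => (P F ∧ B ⊆ F) ∧ (F.card : ℤ) = p - 1) hxy (by
          rintro F hxF hyF ⟨⟨h1, h2⟩, h3⟩
          refine ⟨⟨hy F hxF hyF h1, (Finset.subset_insert_iff_of_notMem hyB).mp h2⟩, ?_⟩
          rw [Finset.card_insert_of_notMem hyF] at h3
          push_cast at h3
          omega) hb (fun F hF => hdb F hF (by simp [hxT]))
      have hP' : ∀ F G, F ⊆ G → (P F ∧ B ⊆ F) → (P G ∧ B ⊆ G) :=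
        fun F G h h' => ⟨hP _ _ h h'.1, h'.2.trans h⟩
      obtain ⟨e₂, he₂, hbe₂⟩ := ih (insert x B)
        (by rw [Finset.disjoint_insert_left]; exact ⟨hxT, hBT⟩)
        (by rw [Finset.compl_insert, Finset.card_erase_of_mem (by simpa using hxB), hm]; rfl)
        (fun x' hx' => hx x' (fun h => hx' (Finset.mem_insert_of_mem h)))
        (b - coboundaryMap e₁) (fun F hF => by
          have hxF := hbe₁ F hF
          have h : (P F ∧ B ⊆ F) ∧ (F.card : ℤ) = p := by
            by_cases h0 : b F = 0
            · rw [Pi.sub_apply, h0, zero_sub, neg_ne_zero] at hF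
              exact coboundaryMap_supported hP' he₁ hF
            · exact hb F h0
          exact ⟨⟨h.1.1, Finset.insert_subset hxF h.1.2⟩, h.2⟩) (fun F hF => by
          rw [coboundaryMap_sub, Pi.sub_apply, coboundaryMap_coboundaryMap, sub_zero] at hF
          exact hdb F hF)
      refine ⟨e₁ + e₂, fun F hF => ?_, fun F hF => ?_⟩
      · by_cases h0 : e₁ F = 0
        · rw [Pi.add_apply, h0, zero_add] at hF
          exact he₂ F hF
        · exact ⟨(he₁ F h0).1.1, (he₁ F h0).2⟩
      · rw [coboundaryMap_add, ← sub_sub] at hF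
        exact hbe₂ F hF
    · push Not at hex
      refine ⟨0, by simp, fun F hF => ?_⟩
      rw [coboundaryMap_zero, sub_zero] at hF
      obtain ⟨⟨h1, h2⟩, h3⟩ := hb F hF
      refine ⟨⟨h1, fun i hi => h2 ?_⟩, h3⟩
      by_contra h
      exact (Finset.mem_compl.mp hi) (hex i h)

end UpSetCohomology

/-! ### Čech cochains of an ideal as families of Laurent coefficients. -/

noncomputable section

section LaurentExpansion

open MvPolynomial CMReg

variable {k : Type*} [Field k] {N : ℕ}

/-- The Laurent polynomial ring `k[ℤ^N]`. -/
abbrev Laurent (k : Type*) [Field k] (N : ℕ) : Type _ := AddMonoidAlgebra k (Fin N → ℤ)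

/-- The exponent vector of a monomial as an integer vector. -/
def intExponent (N : ℕ) : (Fin N →₀ ℕ) →+ (Fin N → ℤ) where
  toFun e i := e i
  map_zero' := by ext; simp
  map_add' e f := by ext; simp

lemma intExponent_apply (e : Fin N →₀ ℕ) (i : Fin N) : intExponent N e i = e i := rfl

lemma intExponent_injective : Function.Injective (intExponent N) := by
  intro e f h
  ext i
  simpa [intExponent] using congrFun h i

/-- The inclusion of the polynomial ring into the Laurent polynomial ring. -/
def toLaurent (k : Type*) [Field k] (N : ℕ) : MvPolynomial (Fin N) k →+* Laurent k N :=
  AddMonoidAlgebra.mapDomainRingHom k (intExponent N)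

instance laurentAlgebra : Algebra (MvPolynomial (Fin N) k) (Laurent k N) :=
  (toLaurent k N).toAlgebra

lemma smul_laurent (f : MvPolynomial (Fin N) k) (x : Laurent k N) :
    f • x = toLaurent k N f * x := rfl

lemma toLaurent_monomial (e : Fin N →₀ ℕ) (r : k) :
    toLaurent k N (monomial e r) = AddMonoidAlgebra.single (intExponent N e) r := by
  simp [toLaurent, monomial]

lemma coeff_toLaurent (f : MvPolynomial (Fin N) k) (e : Fin N →₀ ℕ) :
    (toLaurent k N f).coeff (intExponent N e) = coeff e f :=
  Finsupp.mapDomain_apply intExponent_injective _ _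

lemma exists_of_coeff_toLaurent_ne_zero {f : MvPolynomial (Fin N) k} {a : Fin N → ℤ}
    (h : (toLaurent k N f).coeff a ≠ 0) : ∃ e, intExponent N e = a ∧ coeff e f ≠ 0 := by
  by_cases ha : a ∈ Set.range (intExponent N)
  · obtain ⟨e, rfl⟩ := ha
    exact ⟨e, rfl, by rwa [coeff_toLaurent] at h⟩
  · exact absurd (Finsupp.mapDomain_of_notMem_range _ _ ha) h

lemma toLaurent_injective : Function.Injective (toLaurent k N) := by
  intro f g h
  ext e
  rw [← coeff_toLaurent, h, coeff_toLaurent]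

/-- The indicator vector of `F`. -/
def indicatorVec (F : Finset (Fin N)) (i : Fin N) : ℤ := if i ∈ F then 1 else 0

lemma varProd_pow_eq_monomial (F : Finset (Fin N)) (m : ℕ) :
    varProd k F ^ m = monomial (m • ∑ j ∈ F, Finsupp.single j 1) 1 := by
  have h := monomial_pow (R := k) (s := ∑ j ∈ F, Finsupp.single j 1) (a := 1) (e := m)
  rw [one_pow] at h
  rw [← h, monomial_sum_one]
  rfl

lemma intExponent_sum_single (F : Finset (Fin N)) :
    intExponent N (∑ j ∈ F, Finsupp.single j 1) = indicatorVec F := by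
  funext i
  simp [intExponent, indicatorVec, Finsupp.single_apply]

lemma toLaurent_varProd_pow (F : Finset (Fin N)) (m : ℕ) :
    toLaurent k N (varProd k F ^ m) = AddMonoidAlgebra.single (m • indicatorVec F) 1 := by
  rw [varProd_pow_eq_monomial, toLaurent_monomial, map_nsmul, intExponent_sum_single]

lemma single_mul_single_neg (a : Fin N → ℤ) :
    (AddMonoidAlgebra.single a 1 : Laurent k N) * AddMonoidAlgebra.single (-a) 1 = 1 := by
  rw [AddMonoidAlgebra.single_mul_single]
  simp [AddMonoidAlgebra.one_def]

lemma isUnit_laurent (F : Finset (Fin N)) (x : Submonoid.powers (varProd k F)) :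
    IsUnit (algebraMap (MvPolynomial (Fin N) k)
      (Module.End (MvPolynomial (Fin N) k) (Laurent k N)) x) := by
  obtain ⟨_, m, rfl⟩ := x
  have h : IsUnit (toLaurent k N (varProd k F ^ m)) := by
    rw [toLaurent_varProd_pow]
    exact IsUnit.of_mul_eq_one _ (single_mul_single_neg _)
  rw [Module.End.isUnit_iff]
  exact h.smul_bijective

variable (J : Ideal (MvPolynomial (Fin N) k))

/-- The Laurent expansion of the elements of `J_{x_F}`. -/
def laurentExpansion (F : Finset (Fin N)) :
    Loc (k := k) J F →ₗ[MvPolynomial (Fin N) k] Laurent k N :=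
  LocalizedModule.lift _ (Algebra.linearMap (MvPolynomial (Fin N) k) (Laurent k N) ∘ₗ
    Submodule.subtype J) (isUnit_laurent F)

lemma laurentExpansion_mk_one (F : Finset (Fin N)) (f : J) :
    laurentExpansion J F (LocalizedModule.mk f 1) = toLaurent k N f :=
  LocalizedModule.lift_mk_one ..

lemma single_mul_laurentExpansion (F : Finset (Fin N)) (f : J) (m : ℕ) :
    AddMonoidAlgebra.single (m • indicatorVec F) 1 * laurentExpansion J F
      (LocalizedModule.mk f (⟨varProd k F ^ m, m, rfl⟩ : Submonoid.powers (varProd k F)))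
      = toLaurent k N f := by
  rw [← toLaurent_varProd_pow, ← smul_laurent, ← map_smul, LocalizedModule.smul'_mk,
    ← laurentExpansion_mk_one J F f]
  congr 1
  exact LocalizedModule.mk_cancel (⟨varProd k F ^ m, m, rfl⟩ : Submonoid.powers (varProd k F)) f

lemma laurentExpansion_mk (F : Finset (Fin N)) (f : J) (m : ℕ) :
    laurentExpansion J F
      (LocalizedModule.mk f (⟨varProd k F ^ m, m, rfl⟩ : Submonoid.powers (varProd k F)))
      = AddMonoidAlgebra.single (-(m • indicatorVec F)) 1 * toLaurent k N f := by
  rw [← single_mul_laurentExpansion, ← mul_assoc, mul_comm (AddMonoidAlgebra.single _ _)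
    (AddMonoidAlgebra.single _ _), single_mul_single_neg, one_mul]

lemma coeff_laurentExpansion_mk (F : Finset (Fin N)) (f : J) (m : ℕ) (a : Fin N → ℤ) :
    (laurentExpansion J F (LocalizedModule.mk f
      (⟨varProd k F ^ m, m, rfl⟩ : Submonoid.powers (varProd k F)))).coeff a
      = (toLaurent k N f).coeff (m • indicatorVec F + a) := by
  rw [laurentExpansion_mk, AddMonoidAlgebra.coeff_single_mul_eq_mul_coeff
    (m₂ := m • indicatorVec F + a), one_mul]
  intro b _
  constructor
  · rintro rfl; abel
  · rintro rfl; abel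

lemma laurentExpansion_injective (F : Finset (Fin N)) :
    Function.Injective (laurentExpansion J F) := by
  rw [injective_iff_map_eq_zero]
  intro z hz
  induction z using LocalizedModule.induction_on with
  | h f s =>
    obtain ⟨_, m, rfl⟩ := s
    have h := single_mul_laurentExpansion J F f m
    rw [hz, mul_zero] at h
    have h0 : f = 0 := by
      apply Subtype.ext
      apply toLaurent_injective
      rw [← h]
      simp
    rw [h0, LocalizedModule.zero_mk]

lemma laurentExpansion_locRes {F G : Finset (Fin N)} (h : F ⊆ G) (z : Loc (k := k) J F) :
    laurentExpansion J G (locRes (k := k) J h z) = laurentExpansion J F z := by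
  have : laurentExpansion J G ∘ₗ locRes (k := k) J h = laurentExpansion J F := by
    apply IsLocalizedModule.ext (Submonoid.powers (varProd k F))
      (LocalizedModule.mkLinearMap _ J) (isUnit_laurent F)
    ext f : 1
    simp only [LinearMap.comp_apply, LocalizedModule.mkLinearMap_apply, locRes_mk,
      laurentExpansion_mk_one]
  exact congrArg (fun g => g z) this

/-- The coefficients at `x^a` of a Čech cochain. -/
def cochainCoeff (c : Cochain k (N := N) J) (a : Fin N → ℤ) (F : Finset (Fin N)) : k :=
  (laurentExpansion J F (c F)).coeff a

/-- All localizations embed compatibly in one Laurent ring, so taking the coefficient at `x^a` is a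
map of complexes. -/
lemma cochainCoeff_cechD (c : Cochain k (N := N) J) (a : Fin N → ℤ) :
    cochainCoeff J (cechD J c) a = coboundaryMap (cochainCoeff J c a) := by
  funext G
  rw [cochainCoeff, cechD_apply, map_sum, AddMonoidAlgebra.coeff_sum, Finsupp.finsetSum_apply,
    coboundaryMap]
  refine Finset.sum_congr rfl fun j _ => ?_
  rw [map_smul, laurentExpansion_locRes, smul_laurent, insertSign, cochainCoeff]
  rcases neg_one_pow_eq_or (MvPolynomial (Fin N) k) (G.filter (· < j)).card with h | h <;>
  rcases Nat.even_or_odd (G.filter (· < j)).card with h' | h' <;>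
  simp [h'.neg_one_pow]

lemma cochain_ext {c c' : Cochain k (N := N) J}
    (h : ∀ a, cochainCoeff J c a = cochainCoeff J c' a) : c = c' := by
  funext F
  apply laurentExpansion_injective
  ext a
  exact congrFun (h a) F

/-- The monomial `x^a` lies in `J_{x_F}`. -/
def InLocalization (a : Fin N → ℤ) (F : Finset (Fin N)) : Prop :=
  ∃ e : Fin N →₀ ℕ, monomial e 1 ∈ J ∧ ∀ i ∉ F, (e i : ℤ) ≤ a i

variable {J}

/-- The hypothesis `hJ` says that `J` is a monomial ideal. With `exists_laurentExpansion_eq_single`,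
this identifies the cochains in multidegree `a` with functions on the sets satisfying
`InLocalization`. -/
lemma inLocalization_of_coeff_ne_zero (hJ : ∀ f ∈ J, ∀ e, coeff e f ≠ 0 → monomial e 1 ∈ J)
    {F : Finset (Fin N)} {z : Loc (k := k) J F} {a : Fin N → ℤ}
    (h : (laurentExpansion J F z).coeff a ≠ 0) : InLocalization J a F := by
  induction z using LocalizedModule.induction_on with
  | h f s =>
    obtain ⟨_, m, rfl⟩ := s
    rw [coeff_laurentExpansion_mk] at h
    obtain ⟨e, he, hf⟩ := exists_of_coeff_toLaurent_ne_zero h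
    refine ⟨e, hJ f f.2 e hf, fun i hi => ?_⟩
    rw [← intExponent_apply, he]
    simp [indicatorVec, hi]

lemma sum_eq_of_coeff_ne_zero {F : Finset (Fin N)} {t : ℤ} {z : Loc (k := k) J F}
    (hz : z ∈ locDeg (idealGrading J) F t) {a : Fin N → ℤ}
    (h : (laurentExpansion J F z).coeff a ≠ 0) : ∑ i, a i = t := by
  induction hz using AddSubgroup.closure_induction with
  | mem z hz =>
    obtain ⟨m, f, hf, rfl⟩ := hz
    rw [coeff_laurentExpansion_mk] at h
    obtain ⟨e, he, hfe⟩ := exists_of_coeff_toLaurent_ne_zero h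
    have h1 := hf e hfe
    have h2 : (e.degree : ℤ) = ∑ i, intExponent N e i := by
      simp [Finsupp.degree_eq_sum, intExponent_apply]
    rw [h2, he] at h1
    simp only [Pi.add_apply, Finset.sum_add_distrib, Pi.smul_apply, indicatorVec,
      ← Finset.smul_sum, Finset.sum_ite_mem, Finset.univ_inter, Finset.sum_const] at h1
    simp at h1
    linarith
  | zero => simp at h
  | add x y _ _ hx hy =>
    rw [map_add, AddMonoidAlgebra.coeff_add, Finsupp.add_apply] at h
    by_cases h0 : (laurentExpansion J F x).coeff a = 0
    · exact hy (by simpa [h0] using h)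
    · exact hx h0
  | neg x _ hx => exact hx (by simpa using h)

lemma exists_laurentExpansion_eq_single {F : Finset (Fin N)} {a : Fin N → ℤ}
    (h : InLocalization J a F) (r : k) : ∃ z ∈ locDeg (idealGrading J) F (∑ i, a i),
      laurentExpansion J F z = AddMonoidAlgebra.single a r := by
  obtain ⟨e, heJ, he⟩ := h
  -- Multiplying `x^a` by `x_F ^ m` for such an `m` makes it a multiple of `x^e`, hence a genuine
  -- monomial of `J`.
  obtain ⟨m, hm⟩ : ∃ m : ℕ, ∀ i, (e i : ℤ) - a i ≤ m := by
    refine ⟨∑ i, ((e i : ℤ) - a i).toNat, fun i => ?_⟩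
    refine (Int.self_le_toNat _).trans ?_
    exact_mod_cast Finset.single_le_sum (f := fun i => ((e i : ℤ) - a i).toNat)
      (fun _ _ => Nat.zero_le _) (Finset.mem_univ i)
  have hle : ∀ i, (e i : ℤ) ≤ (m • indicatorVec F + a) i := by
    intro i
    by_cases hi : i ∈ F
    · have := hm i
      simp [indicatorVec, hi]; linarith
    · simpa [indicatorVec, hi] using he i hi
  set e' : Fin N →₀ ℕ := Finsupp.equivFunOnFinite.symm fun i => ((m • indicatorVec F + a) i).toNat
    with he'
  have hint : intExponent N e' = m • indicatorVec F + a := by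
    funext i
    rw [intExponent_apply, he', Finsupp.coe_equivFunOnFinite_symm, Int.toNat_of_nonneg]
    exact le_trans (by positivity) (hle i)
  have hee' : e ≤ e' := by
    intro i
    have := hle i
    rw [← hint, intExponent_apply] at this
    exact_mod_cast this
  have hmem : monomial e' r ∈ J := by
    have : monomial e' r = monomial (e' - e) r * monomial e (1 : k) := by
      rw [monomial_mul, mul_one, tsub_add_cancel_of_le hee']
    rw [this]
    exact J.mul_mem_left _ heJ
  refine ⟨LocalizedModule.mk ⟨monomial e' r, hmem⟩
    (⟨varProd k F ^ m, m, rfl⟩ : Submonoid.powers (varProd k F)),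
    AddSubgroup.subset_closure ⟨m, _, ?_, rfl⟩, ?_⟩
  · intro f hf
    have hf' : f = e' := by
      by_contra hne
      exact hf (by rw [coeff_monomial, if_neg (Ne.symm hne)])
    have h2 : (e'.degree : ℤ) = ∑ i, intExponent N e' i := by
      simp [Finsupp.degree_eq_sum, intExponent_apply]
    rw [hf', h2, hint]
    simp only [Pi.add_apply, Finset.sum_add_distrib, Pi.smul_apply, indicatorVec,
      ← Finset.smul_sum, Finset.sum_ite_mem, Finset.univ_inter, Finset.sum_const]
    simp
    ring
  · rw [laurentExpansion_mk, toLaurent_monomial, AddMonoidAlgebra.single_mul_single, hint]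
    simp

end LaurentExpansion

end

/-! ### Relations among generators of a regular-sequence ideal. -/

section Syzygies

variable {R : Type*} [CommRing R]

/-- The coefficients of a linear relation between the members of a regular sequence lie in the
ideal generated by the sequence. -/
lemma mem_span_range_of_sum_mul_eq_zero : ∀ {r : ℕ} (x : Fin r → R),
    (∀ i, ∀ a, a * x i ∈ Ideal.span (x '' {j | j < i}) → a ∈ Ideal.span (x '' {j | j < i})) →
    ∀ a : Fin r → R, ∑ i, a i * x i = 0 → ∀ i, a i ∈ Ideal.span (Set.range x) := by
  intro r
  induction r with
  | zero => exact fun _ _ _ _ i => i.elim0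
  | succ r ih =>
    intro x hx a ha
    have hlast : x '' {j | j < Fin.last r} = Set.range (x ∘ Fin.castSucc) := by
      ext z
      constructor
      · rintro ⟨j, hj, rfl⟩
        exact ⟨j.castPred (ne_of_lt hj), by simp⟩
      · rintro ⟨j, rfl⟩
        exact ⟨j.castSucc, Fin.castSucc_lt_last j, rfl⟩
    have hsub : Ideal.span (Set.range (x ∘ Fin.castSucc)) ≤ Ideal.span (Set.range x) :=
      Ideal.span_mono (Set.range_comp_subset_range _ _)
    rw [Fin.sum_univ_castSucc] at ha
    have h1 : a (Fin.last r) ∈ Ideal.span (Set.range (x ∘ Fin.castSucc)) := by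
      rw [← hlast]
      apply hx
      rw [hlast, eq_neg_of_add_eq_zero_right ha]
      refine neg_mem (sum_mem fun i _ => Ideal.mul_mem_left _ _ ?_)
      exact Ideal.subset_span ⟨i, rfl⟩
    obtain ⟨b, hb⟩ := Ideal.mem_span_range_iff_exists_fun.mp h1
    -- Writing the last coefficient as `∑ b_i x_i` over the earlier members absorbs the last term
    -- and leaves a relation among those members alone.
    have h2 := ih (x ∘ Fin.castSucc) (fun i c hc => by
      have hi : (x ∘ Fin.castSucc) '' {j | j < i} = x '' {j | j < i.castSucc} := by
        ext z
        constructor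
        · rintro ⟨j, hj, rfl⟩
          exact ⟨j.castSucc, Fin.castSucc_lt_castSucc_iff.mpr hj, rfl⟩
        · rintro ⟨j, hj, rfl⟩
          have hj' : j < i.castSucc := hj
          exact ⟨j.castPred (ne_of_lt (hj'.trans (Fin.castSucc_lt_last i))),
            Fin.lt_def.mpr (Fin.lt_def.mp hj'), rfl⟩
      rw [hi] at hc ⊢
      exact hx _ c hc) (fun i => a i.castSucc + b i * x (Fin.last r)) (by
      rw [← hb, Finset.sum_mul, ← Finset.sum_add_distrib] at ha
      rw [← ha]
      refine Finset.sum_congr rfl fun i _ => ?_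
      simp only [Function.comp_apply]
      ring)
    intro i
    induction i using Fin.lastCases with
    | last => exact hsub h1
    | cast i =>
      have h3 := sub_mem (hsub (h2 i))
        (Ideal.mul_mem_left _ (b i) (Ideal.subset_span ⟨Fin.last r, rfl⟩))
      simpa using h3

lemma isWeaklyRegular_get {rs : List R} (h : RingTheory.Sequence.IsWeaklyRegular R rs)
    (i : Fin rs.length) (a : R) (ha : a * rs.get i ∈ Ideal.span (rs.get '' {j | j < i})) :
    a ∈ Ideal.span (rs.get '' {j | j < i}) := by
  have hset : Ideal.span (rs.get '' {j | j < i})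
      = Ideal.ofList (rs.take i) • (⊤ : Submodule R R) := by
    rw [smul_eq_mul, Ideal.mul_top, Ideal.ofList]
    congr 1
    ext z
    simp only [Set.mem_image, Set.mem_ofPred_eq, List.mem_take_iff_getElem]
    constructor
    · rintro ⟨j, hj, rfl⟩
      exact ⟨j, by simpa using hj, rfl⟩
    · rintro ⟨j, hj, rfl⟩
      have hj' := lt_min_iff.mp hj
      exact ⟨⟨j, hj'.2⟩, hj'.1, rfl⟩
  rw [hset] at ha ⊢
  rw [← Submodule.Quotient.mk_eq_zero] at ha ⊢
  apply h.regular_mod_prev i i.2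
  simp only [smul_zero]
  rw [← Submodule.Quotient.mk_smul, smul_eq_mul, mul_comm a] at *
  exact ha

/-- If an ideal has a generating family all of whose relations have coefficients in the ideal,
so does every generating family whose relations have coefficients in some proper ideal. -/
lemma mem_of_sum_mul_eq_zero_of_span_eq {I m : Ideal R} (hI : I ≠ ⊤) (hm : m ≠ ⊤) {r s : ℕ}
    {x : Fin r → R} {u : Fin s → R} (hx : Ideal.span (Set.range x) = I)
    (hu : Ideal.span (Set.range u) = I)
    (hxI : ∀ a : Fin r → R, ∑ i, a i * x i = 0 → ∀ i, a i ∈ I)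
    (hum : ∀ a : Fin s → R, ∑ i, a i * u i = 0 → ∀ i, a i ∈ m)
    (a : Fin s → R) (ha : ∑ i, a i * u i = 0) (i : Fin s) : a i ∈ I := by
  have h1 : ∀ j, ∃ c : Fin r → R, ∑ i, c i * x i = u j := fun j =>
    Ideal.mem_span_range_iff_exists_fun.mp (by rw [hx, ← hu]; exact Ideal.subset_span ⟨j, rfl⟩)
  have h2 : ∀ i, ∃ c : Fin s → R, ∑ j, c j * u j = x i := fun i =>
    Ideal.mem_span_range_iff_exists_fun.mp (by rw [hu, ← hx]; exact Ideal.subset_span ⟨i, rfl⟩)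
  choose A' hA using h1
  choose B' hB using h2
  let A : Matrix (Fin s) (Fin r) R := A'
  let B : Matrix (Fin r) (Fin s) R := B'
  have hA' : Matrix.mulVec A x = u := funext hA
  have hB' : Matrix.mulVec B u = x := funext hB
  -- The rows of `B * A - 1` are relations among the `x_i`, and those of `A * B - 1` are relations
  -- among the `u_j`.
  have hBA : ∀ i j, (B * A - 1 : Matrix (Fin r) (Fin r) R) i j ∈ I := by
    intro i
    apply hxI
    have : Matrix.mulVec (B * A - 1) x = 0 := by
      rw [Matrix.sub_mulVec, ← Matrix.mulVec_mulVec, hA', hB', Matrix.one_mulVec, sub_self]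
    exact congrFun this i
  have hAB : ∀ i j, (A * B - 1 : Matrix (Fin s) (Fin s) R) i j ∈ m := by
    intro i
    apply hum
    have : Matrix.mulVec (A * B - 1) u = 0 := by
      rw [Matrix.sub_mulVec, ← Matrix.mulVec_mulVec, hB', hA', Matrix.one_mulVec, sub_self]
    exact congrFun this i
  have key : ∀ {p : ℕ} (K : Ideal R) (M : Matrix (Fin p) (Fin p) R),
      (∀ i j, (M - 1) i j ∈ K) → (Ideal.Quotient.mk K).mapMatrix M = 1 := by
    intro p K M hM
    rw [← sub_eq_zero, ← map_one (Ideal.Quotient.mk K).mapMatrix, ← map_sub]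
    ext i j
    exact Ideal.Quotient.eq_zero_iff_mem.mpr (hM i j)
  have hBA1 := key I _ hBA
  have hAB1 := key m _ hAB
  rw [RingHom.mapMatrix_apply, Matrix.map_mul] at hBA1 hAB1
  have : Nontrivial (R ⧸ I) := Ideal.Quotient.nontrivial_iff.mpr hI
  have : Nontrivial (R ⧸ m) := Ideal.Quotient.nontrivial_iff.mpr hm
  have le : ∀ {p q : ℕ} {K : Ideal R} [Nontrivial (R ⧸ K)] (C : Matrix (Fin p) (Fin q) (R ⧸ K))
      (D : Matrix (Fin q) (Fin p) (R ⧸ K)), C * D = 1 → p ≤ q := by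
    intro p q K _ C D h
    have h3 := Matrix.rank_mul_le_left C D
    rw [h, Matrix.rank_one, Fintype.card_fin] at h3
    exact h3.trans (Matrix.rank_le_width C)
  -- Ranks modulo `I` and modulo `m` give the two inequalities. The matrices are then square, so `A`
  -- is invertible modulo `I` on both sides.
  obtain rfl : r = s := le_antisymm (le _ _ hBA1) (le _ _ hAB1)
  have hAB2 := mul_eq_one_comm.mp hBA1
  -- A relation `a` among the `u_j` yields the relation `a A` among the `x_i`, which is zero modulo
  -- `I`; inverting `A` gives `a` zero modulo `I`.
  have h5 : Matrix.vecMul (fun j => Ideal.Quotient.mk I (a j))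
      (A.map (Ideal.Quotient.mk I)) = 0 := by
    have h6 := hxI (Matrix.vecMul a A) (by
      change dotProduct (Matrix.vecMul a A) x = 0
      rw [← Matrix.dotProduct_mulVec, hA']
      exact ha)
    ext j
    rw [Pi.zero_apply, ← Ideal.Quotient.eq_zero_iff_mem.mpr (h6 j)]
    simp [Matrix.vecMul, dotProduct]
  have h7 : (fun j => Ideal.Quotient.mk I (a j)) = 0 := by
    rw [← Matrix.vecMul_one (fun j => Ideal.Quotient.mk I (a j)), ← hAB2, ← Matrix.vecMul_vecMul,
      h5, Matrix.zero_vecMul]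
  exact Ideal.Quotient.eq_zero_iff_mem.mp (congrFun h7 i)

end Syzygies

/-! ### Monomial complete intersections and powers of monomial ideals. -/

section MonomialCompleteIntersection

open MvPolynomial CMReg

variable {k : Type*} [Field k] {N s : ℕ} {I : Ideal (MvPolynomial (Fin N) k)}

lemma monomial_mem_span_range_iff {e : Fin s → Fin N →₀ ℕ} {f : Fin N →₀ ℕ} :
    monomial f (1 : k) ∈ Ideal.span (Set.range fun j => monomial (e j) (1 : k)) ↔
      ∃ j, e j ≤ f := by
  classical
  have : (Set.range fun j => monomial (e j) (1 : k))
      = (fun d => monomial d (1 : k)) '' Set.range e := by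
    rw [← Set.range_comp]; rfl
  rw [this, mem_ideal_span_monomial_image]
  simp [support_monomial]

lemma IsMinimalMonomialGenerators.eq_of_le {e : Fin s → Fin N →₀ ℕ}
    (hu : IsMinimalMonomialGenerators (fun j => monomial (e j) (1 : k)) I) {i j : Fin s}
    (h : e i ≤ e j) : i = j := by
  by_contra hij
  apply hu.irredundant j
  have : monomial (e j) (1 : k) = monomial (e j - e i) 1 * monomial (e i) 1 := by
    rw [monomial_mul, mul_one, tsub_add_cancel_of_le h]
  rw [this]
  exact Ideal.mul_mem_left _ _ (Ideal.subset_span ⟨i, hij, rfl⟩)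

lemma IsCompleteIntersection.ne_top (hI : IsCompleteIntersection I) : I ≠ ⊤ := by
  obtain ⟨rs, hrs, rfl⟩ := hI
  have := hrs.top_ne_smul
  rw [smul_eq_mul, Ideal.mul_top] at this
  exact this.symm

/-- The minimal monomial generators of a complete intersection have disjoint supports. -/
lemma IsCompleteIntersection.disjoint_support (hI : IsCompleteIntersection I)
    {e : Fin s → Fin N →₀ ℕ}
    (hu : IsMinimalMonomialGenerators (fun j => monomial (e j) (1 : k)) I) {i j : Fin s}
    (hij : i ≠ j) (x : Fin N) (hi : e i x ≠ 0) : e j x = 0 := by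
  classical
  by_contra hj
  have htop := IsCompleteIntersection.ne_top hI
  obtain ⟨rs, hrs, hrsI⟩ := hI
  have hspan : Ideal.span (Set.range rs.get) = I := by
    rw [← hrsI, Ideal.ofList]
    congr 1
    ext z
    simp [List.mem_iff_get]
  have hsyz := mem_of_sum_mul_eq_zero_of_span_eq (m := RingHom.ker (constantCoeff (R := k)
    (σ := Fin N))) htop (RingHom.ker_ne_top _) hspan hu.span_eq
    (fun a ha => by
      have := mem_span_range_of_sum_mul_eq_zero rs.get
        (isWeaklyRegular_get hrs.toIsWeaklyRegular) a ha
      rwa [hspan] at this)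
    -- By minimality no other generator divides `x^{e_l}`, so the coefficient of the relation at `e
    -- l` is the constant term of `a l`.
    (fun a ha l => by
      have h := congrArg (coeff (e l)) ha
      rw [coeff_sum, Finset.sum_eq_single_of_mem l (Finset.mem_univ l)] at h
      · rw [coeff_mul_monomial', if_pos le_rfl] at h
        simpa [RingHom.mem_ker, constantCoeff_eq] using h
      · intro b _ hb
        rw [coeff_mul_monomial', if_neg fun h => hb (IsMinimalMonomialGenerators.eq_of_le hu h)])
  have hle : ∀ l, e l x ≠ 0 → Finsupp.single x 1 ≤ e l := by
    intro l hl
    rw [Finsupp.single_le_iff]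
    omega
  -- The relation `(u_j / x) u_i - (u_i / x) u_j = 0` puts `u_j / x` in `I`. A generator dividing it
  -- divides `u_j`, so it equals `u_j`, which is impossible.
  have hmem := hsyz (Function.update (Function.update 0 j
    (-monomial (e i - Finsupp.single x 1) 1)) i (monomial (e j - Finsupp.single x 1) 1)) (by
      rw [Finset.sum_eq_add_of_mem i j (Finset.mem_univ _) (Finset.mem_univ _) hij]
      · rw [Function.update_self, Function.update_of_ne hij.symm, Function.update_self,
          neg_mul, monomial_mul, monomial_mul, add_neg_eq_zero]
        rw [tsub_add_eq_add_tsub (hle j hj), tsub_add_eq_add_tsub (hle i hi), add_comm]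
      · rintro l - ⟨h1, h2⟩
        rw [Function.update_of_ne h1, Function.update_of_ne h2]
        simp) i
  rw [Function.update_self, ← hu.span_eq, monomial_mem_span_range_iff] at hmem
  obtain ⟨l, hl⟩ := hmem
  have hlj : l = j := IsMinimalMonomialGenerators.eq_of_le hu (hl.trans tsub_le_self)
  subst hlj
  have := hl x
  simp at this
  omega

/-- Membership in the powers of a monomial ideal. -/
lemma mem_span_monomial_pow_iff {e : Fin s → Fin N →₀ ℕ} {n : ℕ} {f : MvPolynomial (Fin N) k} :
    f ∈ Ideal.span (Set.range fun j => monomial (e j) (1 : k)) ^ n ↔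
      ∀ d ∈ f.support, ∃ c : Fin s → ℕ, n ≤ ∑ j, c j ∧ ∑ j, c j • e j ≤ d := by
  have hspan : Ideal.span (Set.range fun j => monomial (e j) (1 : k)) ^ n
      = Ideal.span ((fun d => monomial d (1 : k)) ''
        {d | ∃ c : Fin s → ℕ, n ≤ ∑ j, c j ∧ ∑ j, c j • e j = d}) := by
    apply le_antisymm
    · induction n with
      | zero =>
        rw [pow_zero, Ideal.one_eq_top, top_le_iff, Ideal.eq_top_iff_one]
        exact Ideal.subset_span ⟨0, ⟨0, by simp⟩, rfl⟩
      | succ n ih =>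
        rw [pow_succ]
        refine (Ideal.mul_mono_left ih).trans ?_
        rw [Ideal.span_mul_span', Ideal.span_le]
        rintro _ ⟨_, ⟨_, ⟨c, hc, rfl⟩, rfl⟩, _, ⟨i, rfl⟩, rfl⟩
        -- One more factor `x^{e_i}` raises the exponent `c i` by one.
        refine Ideal.subset_span ⟨∑ j, (c + Pi.single i 1 : Fin s → ℕ) j • e j, ⟨(c + Pi.single i 1 : Fin s → ℕ), ?_, rfl⟩, ?_⟩
        · simpa [Finset.sum_add_distrib] using hc
        · simp [add_smul, Finset.sum_add_distrib, monomial_mul, Pi.single_apply, ite_smul]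
    · rw [Ideal.span_le]
      rintro _ ⟨_, ⟨c, hc, rfl⟩, rfl⟩
      refine Ideal.pow_le_pow_right hc ?_
      rw [← Finset.prod_pow_eq_pow_sum]
      have : monomial (∑ j, c j • e j) (1 : k) = ∏ j, monomial (e j) (1 : k) ^ c j := by
        rw [monomial_sum_one]
        refine Finset.prod_congr rfl fun j _ => ?_
        rw [monomial_pow, one_pow]
      change monomial (∑ j, c j • e j) (1 : k) ∈ _
      rw [this]
      refine Ideal.prod_mem_prod fun j _ => Ideal.pow_mem_pow ?_ _
      exact Ideal.subset_span ⟨j, rfl⟩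
  rw [hspan, mem_ideal_span_monomial_image]
  simp

lemma monomial_mem_pow_iff {e : Fin s → Fin N →₀ ℕ} {n : ℕ} {f : Fin N →₀ ℕ} :
    monomial f (1 : k) ∈ Ideal.span (Set.range fun j => monomial (e j) (1 : k)) ^ n ↔
      ∃ c : Fin s → ℕ, n ≤ ∑ j, c j ∧ ∑ j, c j • e j ≤ f := by
  classical
  rw [mem_span_monomial_pow_iff]
  simp [support_monomial]

lemma monomial_mem_of_mem_pow {e : Fin s → Fin N →₀ ℕ} {n : ℕ} {f : MvPolynomial (Fin N) k}
    (hf : f ∈ Ideal.span (Set.range fun j => monomial (e j) (1 : k)) ^ n) {d : Fin N →₀ ℕ}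
    (hd : coeff d f ≠ 0) :
    monomial d (1 : k) ∈ Ideal.span (Set.range fun j => monomial (e j) (1 : k)) ^ n :=
  monomial_mem_pow_iff.mpr (mem_span_monomial_pow_iff.mp hf d (mem_support_iff.mpr hd))

end MonomialCompleteIntersection

/-! ### Cohomology of the up-sets attached to generators with disjoint supports. -/

section DisjointGenerators

variable {k : Type*} [Field k] {N s : ℕ}

/-- The Laurent monomial `x^a` is divisible, away from the variables in `F`, by a product of at
least `n` of the monomials `x^{e_j}`. -/
def DivisibleAway (e : Fin s → Fin N →₀ ℕ) (n : ℕ) (a : Fin N → ℤ) (F : Finset (Fin N)) : Prop :=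
  ∃ c : Fin s → ℕ, n ≤ ∑ j, c j ∧ ∀ i ∉ F, ((∑ j, c j * e j i : ℕ) : ℤ) ≤ a i

variable {e : Fin s → Fin N →₀ ℕ} {n : ℕ} {a : Fin N → ℤ}

lemma DivisibleAway.mono {F G : Finset (Fin N)} (h : F ⊆ G) (hF : DivisibleAway e n a F) :
    DivisibleAway e n a G := by
  obtain ⟨c, hc, h'⟩ := hF
  exact ⟨c, hc, fun i hi => h' i fun hF => hi (h hF)⟩

lemma DivisibleAway.nonneg {F : Finset (Fin N)} (hF : DivisibleAway e n a F) {i : Fin N}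
    (hi : i ∉ F) : 0 ≤ a i := by
  obtain ⟨c, hc, h'⟩ := hF
  exact le_trans (by positivity) (h' i hi)

/-- Once `F` contains the support of `e l`, the power `n` of that generator costs nothing outside
`F`. -/
lemma divisibleAway_of_support_subset {F : Finset (Fin N)} (ha : ∀ i ∉ F, 0 ≤ a i) {l : Fin s}
    (hl : ∀ i ∉ F, e l i = 0) : DivisibleAway e n a F := by
  refine ⟨Pi.single l n, by simp, fun i hi => ?_⟩
  rw [Finset.sum_eq_single_of_mem l (Finset.mem_univ l) (fun j _ hj => by
    rw [Pi.single_eq_of_ne hj, zero_mul]), hl i hi]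
  simpa using ha i hi

lemma sum_mul_eq_of_ne_zero (hd : ∀ i j, i ≠ j → ∀ x, e i x ≠ 0 → e j x = 0) {j : Fin s}
    {x : Fin N} (hx : e j x ≠ 0) (c : Fin s → ℕ) : ∑ l, c l * e l x = c j * e j x :=
  Finset.sum_eq_single_of_mem j (Finset.mem_univ j) fun l _ hl => by
    rw [hd j l hl.symm x hx, mul_zero]

/-- At `x` and `y` only the exponent of the `j`-th generator is constrained, and the constraint at
`x` implies the one at `y`. So `y` may be dropped from any set that avoids `x`. -/
lemma DivisibleAway.of_insert (hd : ∀ i j, i ≠ j → ∀ x, e i x ≠ 0 → e j x = 0) {j : Fin s}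
    {x y : Fin N} (hx : e j x ≠ 0) (hy : e j y ≠ 0)
    (hxy : ∀ m : ℕ, (m : ℤ) * e j x ≤ a x → (m : ℤ) * e j y ≤ a y) {F : Finset (Fin N)}
    (hxF : x ∉ F) (hne : x ≠ y) (h : DivisibleAway e n a (insert y F)) : DivisibleAway e n a F := by
  obtain ⟨c, hc, h'⟩ := h
  refine ⟨c, hc, fun i hi => ?_⟩
  by_cases hiy : i = y
  · subst hiy
    have h1 := h' x (by simp [hxF, hne])
    rw [sum_mul_eq_of_ne_zero hd hx] at h1
    rw [sum_mul_eq_of_ne_zero hd hy]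
    push_cast at h1 ⊢
    exact hxy _ h1
  · exact h' i (by simp [hi, hiy])

section Transversal

variable {y : Fin s → Fin N}

lemma transversal_injective (hd : ∀ i j, i ≠ j → ∀ x, e i x ≠ 0 → e j x = 0)
    (hy : ∀ j, e j (y j) ≠ 0) : Function.Injective y := by
  intro i j hij
  by_contra hne
  exact hy j (hij ▸ hd i j hne (y i) (hy i))

/-- The only point of the transversal in the support of `e l` is `y l`, so `F` contains that whole
support. -/
lemma divisibleAway_of_transversal (hd : ∀ i j, i ≠ j → ∀ x, e i x ≠ 0 → e j x = 0)
    (hy : ∀ j, e j (y j) ≠ 0) (hy0 : ∀ j, 0 ≤ a (y j)) {F : Finset (Fin N)}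
    (hF : (Finset.univ.image y)ᶜ ⊆ F) {l : Fin s} (hl : y l ∈ F) : DivisibleAway e n a F := by
  have h : ∀ i ∉ F, ∃ j, y j = i := by
    intro i hi
    by_contra hne
    exact hi (hF (by simpa using hne))
  refine divisibleAway_of_support_subset (l := l) ?_ ?_
  · intro i hi
    obtain ⟨j, rfl⟩ := h i hi
    exact hy0 j
  · intro i hi
    obtain ⟨j, rfl⟩ := h i hi
    exact hd j l (fun hjl => hi (hjl ▸ hl)) _ (hy j)

/-- Reduction of cochains to the sets containing the complement of a transversal through points
where the exponents are largest. -/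
lemma exists_sub_coboundaryMap_transversal (hd : ∀ i j, i ≠ j → ∀ x, e i x ≠ 0 → e j x = 0)
    (hy : ∀ j, e j (y j) ≠ 0) (hy0 : ∀ j, 0 ≤ a (y j))
    (hmax : ∀ j x, e j x ≠ 0 → ∀ m : ℕ, (m : ℤ) * e j x ≤ a x → (m : ℤ) * e j (y j) ≤ a (y j))
    (hcov : ∀ x, 0 ≤ a x → ∃ j, e j x ≠ 0) {p : ℤ} {b : Finset (Fin N) → k}
    (hb : ∀ F, b F ≠ 0 → DivisibleAway e n a F ∧ (F.card : ℤ) = p)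
    (hdb : ∀ F, coboundaryMap b F ≠ 0 → (Finset.univ.image y)ᶜ ⊆ F) :
    ∃ c : Finset (Fin N) → k, (∀ F, c F ≠ 0 → DivisibleAway e n a F ∧ (F.card : ℤ) = p - 1) ∧
      ∀ F, (b - coboundaryMap c) F ≠ 0 →
        (DivisibleAway e n a F ∧ (Finset.univ.image y)ᶜ ⊆ F) ∧ (F.card : ℤ) = p := by
  -- The reduction starts from the set of negative coordinates, which every admissible `F` contains.
  refine exists_sub_coboundaryMap_supported_compl (fun F G h => DivisibleAway.mono h)
    (Finset.univ.image y) p _ (Finset.univ.filter fun i => a i < 0) ?_ rfl ?_ b ?_ hdb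
  · rw [Finset.disjoint_right]
    intro i hi
    obtain ⟨j, -, rfl⟩ := Finset.mem_image.mp hi
    simpa using hy0 j
  · intro x hx hxT
    obtain ⟨j, hj⟩ := hcov x (by simpa using hx)
    refine ⟨y j, by simp, fun F hxF _ h => ?_⟩
    refine DivisibleAway.of_insert hd hj (hy j) (hmax j x hj) hxF ?_ h
    rintro rfl
    exact hxT (by simp)
  · intro F hF
    refine ⟨⟨(hb F hF).1, fun i hi => ?_⟩, (hb F hF).2⟩
    by_contra h
    exact absurd ((hb F hF).1.nonneg h) (by simpa using hi)

end Transversal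

/-- The quotient `a x / e j x` is an integer floor: the largest exponent of the `j`-th generator
allowed at `x`. -/
lemma exists_transversal_of_max (h : ∀ j, ∃ x, e j x ≠ 0 ∧ 0 ≤ a x) :
    ∃ y : Fin s → Fin N, ∀ j, e j (y j) ≠ 0 ∧ 0 ≤ a (y j) ∧
      ∀ x, e j x ≠ 0 → a x / e j x ≤ a (y j) / e j (y j) := by
  choose x₀ hx₀ using h
  have : ∀ j, ∃ y, e j y ≠ 0 ∧ 0 ≤ a y ∧ ∀ x, e j x ≠ 0 → a x / e j x ≤ a y / e j y := by
    intro j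
    obtain ⟨y, hy, hmax⟩ := (Finset.univ.filter fun x => e j x ≠ 0).exists_max_image
      (fun x => a x / e j x) ⟨x₀ j, by simpa using (hx₀ j).1⟩
    simp only [Finset.mem_filter, Finset.mem_univ, true_and] at hy hmax
    refine ⟨y, hy, ?_, hmax⟩
    have h1 := (Int.ediv_nonneg (hx₀ j).2 (by positivity : (0 : ℤ) ≤ e j (x₀ j))).trans
      (hmax (x₀ j) (hx₀ j).1)
    by_contra hneg
    exact absurd h1 (not_le.mpr (Int.ediv_neg_of_neg_of_pos (not_le.mp hneg)
      (by exact_mod_cast Nat.pos_of_ne_zero hy)))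
  choose y hy using this
  exact ⟨y, hy⟩

/-- Moving all the weight to the generator of top degree can only increase the sum. -/
lemma sum_mul_degree_le {w : Fin s → ℕ} (hw : ∑ j, w j ≤ n - 1) (hn : 1 ≤ n) {l : Fin s}
    (hl : ∀ j, (e j).degree ≤ (e l).degree) :
    ∑ j, ((w j : ℤ) + 1) * (e j).degree ≤
      n * (e l).degree + ∑ j ∈ Finset.univ.erase l, ((e j).degree : ℤ) := by
  have h1 : ∑ j, ((w j : ℤ) + 1) * (e j).degree
      = ∑ j, (w j : ℤ) * (e j).degree + ∑ j, ((e j).degree : ℤ) := by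
    rw [← Finset.sum_add_distrib]
    exact Finset.sum_congr rfl fun j _ => by ring
  have h2 : ∑ j, (w j : ℤ) * (e j).degree ≤ ∑ j, (w j : ℤ) * (e l).degree :=
    Finset.sum_le_sum fun j _ => by
      have := hl j
      gcongr
  have h3 : (∑ j, (w j : ℤ)) ≤ n - 1 := by
    have : ((∑ j, w j : ℕ) : ℤ) ≤ ((n - 1 : ℕ) : ℤ) := by exact_mod_cast hw
    push_cast [Nat.cast_sub hn] at this
    exact this
  have h4 : (∑ j, (w j : ℤ)) * (e l).degree ≤ ((n : ℤ) - 1) * (e l).degree := by gcongr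
  rw [← Finset.sum_mul] at h2
  have h5 := Finset.add_sum_erase Finset.univ (fun j => ((e j).degree : ℤ)) (Finset.mem_univ l)
  linarith

lemma sum_lt_of_forall_lt {w : Fin s → ℤ}
    (h : ∀ i, a i + 1 ≤ ∑ j, w j * e j i) :
    ∑ i, a i + N ≤ ∑ j, w j * (e j).degree := by
  have h1 : ∑ i, (a i + 1) ≤ ∑ i, ∑ j, w j * e j i := Finset.sum_le_sum fun i _ => h i
  rw [Finset.sum_comm] at h1
  simp only [← Finset.mul_sum, Finset.sum_add_distrib] at h1
  simpa [Finsupp.degree_eq_sum] using h1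

/-- Vanishing of the multigraded pieces of the local cohomology of `I ^ n`. -/
lemma exists_coboundaryMap_eq_of_lt (hd : ∀ i j, i ≠ j → ∀ x, e i x ≠ 0 → e j x = 0)
    (he : ∀ j, e j ≠ 0) (hn : 1 ≤ n) {l : Fin s} (hl : ∀ j, (e j).degree ≤ (e l).degree)
    {p : ℤ} (hp : (n : ℤ) * (e l).degree + ∑ j ∈ Finset.univ.erase l, ((e j).degree : ℤ)
      - ((s : ℤ) - 1) < ∑ i, a i + p) {c : Finset (Fin N) → k}
    (hc : ∀ F, c F ≠ 0 → DivisibleAway e n a F ∧ (F.card : ℤ) = p)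
    (hdc : coboundaryMap c = 0) :
    ∃ b : Finset (Fin N) → k, (∀ F, b F ≠ 0 → DivisibleAway e n a F ∧ (F.card : ℤ) = p - 1) ∧
      coboundaryMap b = c := by
  have hcard : ∀ {y : Fin N} {F : Finset (Fin N)}, y ∉ F → ((insert y F).card : ℤ) = p →
      (F.card : ℤ) = p - 1 := by
    intro y F hyF h
    rw [Finset.card_insert_of_notMem hyF] at h
    push_cast at h
    omega
  -- Divisibility imposes no constraint at such a `y`, so the up-set is a cone over it.
  by_cases hA : ∃ y, 0 ≤ a y ∧ ∀ j, e j y = 0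
  · obtain ⟨y, hay, hy⟩ := hA
    refine exists_coboundaryMap_eq_of_cone y (fun F hyF h => ⟨?_, hcard hyF h.2⟩) hc hdc
    obtain ⟨m, hm, h'⟩ := h.1
    refine ⟨m, hm, fun i hi => ?_⟩
    by_cases hiy : i = y
    · subst hiy
      simpa [hy] using hay
    · exact h' i (by simp [hi, hiy])
  -- Admissible sets contain all negative coordinates, hence the support of `e j`; conversely any
  -- set containing the negative coordinates is admissible.
  by_cases hB : ∃ j, ∀ x, e j x ≠ 0 → a x < 0
  · obtain ⟨j, hj⟩ := hB
    by_cases hneg : ∃ y, 0 ≤ a y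
    · obtain ⟨y, hay⟩ := hneg
      refine exists_coboundaryMap_eq_of_cone y (fun F hyF h => ⟨?_, hcard hyF h.2⟩) hc hdc
      have hnn : ∀ i ∉ F, 0 ≤ a i := by
        intro i hi
        by_cases hiy : i = y
        · exact hiy ▸ hay
        · exact h.1.nonneg (by simp [hi, hiy])
      refine divisibleAway_of_support_subset hnn (l := j) fun i hi => ?_
      by_contra hne
      exact absurd (hnn i hi) (not_le.mpr (hj i hne))
    -- Only the full set is admissible, so a nonzero cochain has `p = N` and `|a| + p ≤ 0`. The
    -- bound is nonnegative because every generator has degree at least one.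
    · push Not at hneg
      refine ⟨0, by simp, ?_⟩
      rw [coboundaryMap_zero]
      symm
      funext F
      by_contra hF
      obtain ⟨h1, h2⟩ := hc F hF
      have hFu : F = Finset.univ := by
        ext i
        simp only [Finset.mem_univ, iff_true]
        by_contra hi
        exact absurd (h1.nonneg hi) (not_le.mpr (hneg i))
      rw [hFu, Finset.card_univ, Fintype.card_fin] at h2
      have h3 : ∑ i, a i ≤ ∑ _i : Fin N, (-1 : ℤ) := Finset.sum_le_sum fun i _ => by
        have := hneg i
        omega
      have h4 : ∑ _j ∈ Finset.univ.erase l, (1 : ℤ)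
          ≤ ∑ j ∈ Finset.univ.erase l, ((e j).degree : ℤ) := Finset.sum_le_sum fun j _ => by
        have : (e j).degree ≠ 0 := fun h => he j ((Finsupp.degree_eq_zero_iff _).mp h)
        omega
      have h5 : (0 : ℤ) ≤ n * (e l).degree := by positivity
      have h6 := Finset.card_erase_add_one (Finset.mem_univ l)
      rw [Finset.card_univ, Fintype.card_fin] at h6
      rw [Finset.sum_const, nsmul_one] at h4
      simp only [Finset.sum_const, Finset.card_univ, Fintype.card_fin, nsmul_eq_mul] at h3
      omega
  push Not at hA hB
  obtain ⟨y, hy⟩ := exists_transversal_of_max hB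
  have hye : ∀ j, e j (y j) ≠ 0 := fun j => (hy j).1
  have hpos : ∀ {j : Fin s} {x : Fin N}, e j x ≠ 0 → (0 : ℤ) < e j x := fun h => by
    exact_mod_cast Nat.pos_of_ne_zero h
  have hcT : (((Finset.univ.image y)ᶜ).card : ℤ) = N - s := by
    have h1 := Finset.card_compl_add_card (Finset.univ.image y)
    rw [Finset.card_image_of_injective _ (transversal_injective hd hye)] at h1
    simp at h1
    omega
  obtain ⟨b, hb, hcb⟩ := exists_sub_coboundaryMap_transversal hd hye (fun j => (hy j).2.1)
    (fun j x hx m hm => by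
      rw [← Int.le_ediv_iff_mul_le (hpos (hye j))]
      exact ((Int.le_ediv_iff_mul_le (hpos hx)).mpr hm).trans ((hy j).2.2 x hx)) hA hc
    (by simp [hdc])
  obtain ⟨b', hb', hcb'⟩ := exists_coboundaryMap_eq_of_cone
    (Q := fun F => DivisibleAway e n a F ∧ (F.card : ℤ) = p - 1) (y l)
    (fun F hlF h => by
      refine ⟨?_, hcard hlF h.2⟩
      have hTF : (Finset.univ.image y)ᶜ ⊆ F :=
        (Finset.subset_insert_iff_of_notMem (by simp)).mp h.1.2
      -- The cone over `y l` can fail only at `F = Tᶜ`, with `T` the transversal; there the degree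
      -- hypothesis forces admissibility.
      by_cases hex : ∃ j, y j ∈ F
      · obtain ⟨j, hj⟩ := hex
        exact divisibleAway_of_transversal hd hye (fun j => (hy j).2.1) hTF hj
      · have hF : F = (Finset.univ.image y)ᶜ := by
          refine (hTF.antisymm fun i hi => ?_).symm
          rw [Finset.mem_compl, Finset.mem_image]
          rintro ⟨j, -, rfl⟩
          exact hex ⟨j, hi⟩
        have hFc := hcard hlF h.2
        rw [hF, hcT] at hFc
        set w : Fin s → ℕ := fun j => (a (y j) / e j (y j)).toNat with hw
        have hwc : ∀ j, (w j : ℤ) = a (y j) / e j (y j) := fun j =>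
          Int.toNat_of_nonneg (Int.ediv_nonneg (hy j).2.1 (hpos (hye j)).le)
        refine ⟨w, ?_, fun i hi => ?_⟩
        · by_contra hlt
          have h1 := sum_mul_degree_le (w := w) (by omega) hn hl
          -- The maximality of the quotient at `y j` gives `a i < (w j + 1) * e j i` on the support
          -- of `e j`; elsewhere `a i` is negative.
          have h2 := sum_lt_of_forall_lt (a := a) (e := e) (w := fun j => (w j : ℤ) + 1)
            (fun i => by
              by_cases hi : 0 ≤ a i
              · obtain ⟨j, hj⟩ := hA i hi
                refine le_trans ?_ (Finset.single_le_sum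
                  (f := fun j => ((w j : ℤ) + 1) * e j i) (fun j _ => by positivity)
                  (Finset.mem_univ j))
                have h3 := (hy j).2.2 i hj
                rw [← hwc j] at h3
                exact (Int.ediv_lt_iff_lt_mul (hpos hj)).mp (Int.lt_add_one_iff.mpr h3)
              · refine le_trans ?_ (Finset.sum_nonneg fun j _ => by positivity)
                omega)
          linarith
        · rw [hF, Finset.notMem_compl, Finset.mem_image] at hi
          obtain ⟨j, -, rfl⟩ := hi
          rw [sum_mul_eq_of_ne_zero hd (hye j)]
          push_cast
          rw [hwc]
          exact Int.ediv_mul_le _ (hpos (hye j)).ne')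
    hcb (by rw [coboundaryMap_sub, hdc]; funext F; simp [coboundaryMap_coboundaryMap])
  refine ⟨b + b', fun F hF => ?_, ?_⟩
  · by_cases h0 : b F = 0
    · rw [Pi.add_apply, h0, zero_add] at hF
      exact hb' F hF
    · exact hb F h0
  · rw [coboundaryMap_add, hcb']
    abel

lemma card_le_of_disjoint_support (hd : ∀ i j, i ≠ j → ∀ x, e i x ≠ 0 → e j x = 0)
    (he : ∀ j, e j ≠ 0) : s ≤ N := by
  have h : ∀ j, ∃ x, e j x ≠ 0 := fun j => DFunLike.ne_iff.mp (he j)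
  choose y hy using h
  simpa using Fintype.card_le_of_injective y (transversal_injective hd hy)

/-- The multigraded piece of the local cohomology of `I ^ n` in which the regularity is
attained. -/
lemma exists_cocycle_not_coboundary (k : Type*) [Field k]
    (hd : ∀ i j, i ≠ j → ∀ x, e i x ≠ 0 → e j x = 0)
    (he : ∀ j, e j ≠ 0) (hn : 1 ≤ n) (l : Fin s) :
    ∃ a : Fin N → ℤ, ∑ i, a i + N = n * (e l).degree
        + ∑ j ∈ Finset.univ.erase l, ((e j).degree : ℤ) ∧
      ∃ c : Finset (Fin N) → k,
        (∀ F, c F ≠ 0 → DivisibleAway e n a F ∧ (F.card : ℤ) = N - s + 1) ∧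
        coboundaryMap c = 0 ∧
        ∀ b : Finset (Fin N) → k,
          (∀ F, b F ≠ 0 → DivisibleAway e n a F ∧ (F.card : ℤ) = N - s) →
          coboundaryMap b ≠ c := by
  have h : ∀ j, ∃ x, e j x ≠ 0 := fun j => DFunLike.ne_iff.mp (he j)
  choose y hy using h
  have hpos : ∀ {j : Fin s} {x : Fin N}, e j x ≠ 0 → (0 : ℤ) < e j x := fun h => by
    exact_mod_cast Nat.pos_of_ne_zero h
  set w : Fin s → ℕ := Pi.single l (n - 1) with hw
  have hwsum : ∑ j, w j = n - 1 := by simp [hw]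
  -- The largest multidegree whose quotients on the supports are the `w j`. They are constant on
  -- each support, so any choice of transversal works.
  set a : Fin N → ℤ := fun i => ∑ j, ((w j : ℤ) + 1) * e j i - 1 with ha
  have hae : ∀ {j x}, e j x ≠ 0 → a x = ((w j : ℤ) + 1) * e j x - 1 := by
    intro j x hx
    have := sum_mul_eq_of_ne_zero hd hx (fun j => w j + 1)
    rw [ha]
    simp only
    rw [sub_left_inj]
    exact_mod_cast this
  have hmul : ∀ {j x}, e j x ≠ 0 → ∀ m : ℕ, (m : ℤ) * e j x ≤ a x ↔ m ≤ w j := by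
    intro j x hx m
    rw [hae hx, Int.le_sub_one_iff, mul_lt_mul_iff_left₀ (hpos hx)]
    omega
  have ha0 : ∀ {j x}, e j x ≠ 0 → 0 ≤ a x := fun {j x} hx => by
    simpa using (hmul hx 0).mpr (Nat.zero_le _)
  have hcT : (((Finset.univ.image y)ᶜ).card : ℤ) = N - s := by
    have h1 := Finset.card_compl_add_card (Finset.univ.image y)
    rw [Finset.card_image_of_injective _ (transversal_injective hd hy)] at h1
    simp at h1
    omega
  have hnot : ¬ DivisibleAway e n a (Finset.univ.image y)ᶜ := by
    rintro ⟨c, hc, h'⟩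
    have : ∑ j, c j ≤ ∑ j, w j := Finset.sum_le_sum fun j _ => by
      have h1 := h' (y j) (by simp)
      rw [sum_mul_eq_of_ne_zero hd (hy j)] at h1
      push_cast at h1
      exact (hmul (hy j) _).mp h1
    omega
  -- The coboundary of the indicator of `Tᶜ` is supported on admissible sets, although `Tᶜ` itself
  -- is not admissible by `hnot`.
  refine ⟨a, ?_, coboundaryMap (Pi.single (Finset.univ.image y)ᶜ 1), ?_, ?_, ?_⟩
  · rw [ha, Finset.sum_sub_distrib, Finset.sum_comm]
    simp only [← Finset.mul_sum]
    have h1 : ∀ j, ∑ i, (e j i : ℤ) = (e j).degree := fun j => by simp [Finsupp.degree_eq_sum]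
    simp only [h1]
    rw [← Finset.add_sum_erase _ _ (Finset.mem_univ l)]
    have h2 : ∑ j ∈ Finset.univ.erase l, ((w j : ℤ) + 1) * (e j).degree
        = ∑ j ∈ Finset.univ.erase l, ((e j).degree : ℤ) := Finset.sum_congr rfl fun j hj => by
      simp [hw, Finset.ne_of_mem_erase hj]
    rw [h2]
    simp [hw, Nat.cast_sub hn]
  · intro F hF
    obtain ⟨i, hi, h1⟩ := Finset.exists_ne_zero_of_sum_ne_zero hF
    have h2 : F.erase i = (Finset.univ.image y)ᶜ := by
      by_contra hne
      exact h1 (by rw [Pi.single_eq_of_ne hne, mul_zero])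
    have h3 : i ∉ (Finset.univ.image y)ᶜ := by simp [← h2]
    rw [Finset.notMem_compl, Finset.mem_image] at h3
    obtain ⟨j, -, rfl⟩ := h3
    refine ⟨divisibleAway_of_transversal hd hy (fun j => ha0 (hy j))
      (h2 ▸ F.erase_subset _) hi, ?_⟩
    rw [← hcT, ← h2, ← Finset.card_erase_add_one hi]
    push_cast
    rfl
  · funext F
    exact coboundaryMap_coboundaryMap _ F
  · intro b hb hbc
    obtain ⟨b', -, hbb'⟩ := exists_sub_coboundaryMap_transversal hd hy (fun j => ha0 (hy j))
      (fun j x hx m hm => (hmul (hy j) m).mpr ((hmul hx m).mp hm))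
      (fun x hx => by
        by_contra hne
        push Not at hne
        simp [ha, hne] at hx) hb (fun F hF => by
        rw [hbc] at hF
        obtain ⟨i, hi, h1⟩ := Finset.exists_ne_zero_of_sum_ne_zero hF
        have h2 : F.erase i = (Finset.univ.image y)ᶜ := by
          by_contra hne
          exact h1 (by rw [Pi.single_eq_of_ne hne, mul_zero])
        exact h2 ▸ F.erase_subset _)
    -- After reduction only `Tᶜ` has the right cardinality, and it is not admissible. So `b` is a
    -- coboundary and its own coboundary is zero, unlike the chosen cocycle at `insert (y l) Tᶜ`.
    have hb0 : b = coboundaryMap b' := by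
      rw [← sub_eq_zero]
      funext F
      by_contra hF
      obtain ⟨⟨h1, h2⟩, h3⟩ := hbb' F hF
      have h4 := Finset.eq_of_subset_of_card_le h2 (by omega)
      exact hnot (h4 ▸ h1)
    have h1 : coboundaryMap (Pi.single (Finset.univ.image y)ᶜ (1 : k))
        (insert (y l) (Finset.univ.image y)ᶜ) = 0 := by
      rw [← hbc, hb0, coboundaryMap_coboundaryMap]
    have hyl : y l ∉ (Finset.univ.image y)ᶜ := by simp
    rw [coboundaryMap, Finset.sum_eq_single_of_mem (y l) (Finset.mem_insert_self _ _),
      Finset.erase_insert hyl, Pi.single_eq_same, mul_one] at h1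
    · have h2 := insertSign_mul_self (k := k) (y l) (insert (y l) (Finset.univ.image y)ᶜ)
      rw [h1] at h2
      simp at h2
    · intro i hi hil
      rw [Pi.single_eq_of_ne, mul_zero]
      intro h2
      exact hyl (h2 ▸ Finset.mem_erase.mpr ⟨hil.symm, Finset.mem_insert_self _ _⟩)

end DisjointGenerators

/-! ### From multidegrees back to local cohomology and the regularity. -/

section Regularity

open MvPolynomial CMReg

variable {k : Type*} [Field k] {N s : ℕ}

lemma nontrivial_localCohomologyDeg_iff {M : Type*} [AddCommGroup M]
    [Module (MvPolynomial (Fin N) k) M] (𝓜 : ℤ → AddSubgroup M) (i : ℕ) (t : ℤ) :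
    Nontrivial (LocalCohomologyDeg (k := k) (N := N) 𝓜 i t) ↔
      ¬ cocycles (N := N) k 𝓜 i t ≤ coboundaries (N := N) k 𝓜 i t := by
  rw [← not_subsingleton_iff_nontrivial, QuotientAddGroup.subsingleton_iff,
    AddSubgroup.addSubgroupOf_eq_top]

lemma inLocalization_span_pow_iff {e : Fin s → Fin N →₀ ℕ} {n : ℕ} {a : Fin N → ℤ}
    {F : Finset (Fin N)} :
    InLocalization (Ideal.span (Set.range fun j => monomial (e j) (1 : k)) ^ n) a F ↔
      DivisibleAway e n a F := by
  constructor
  · rintro ⟨d, hd, h⟩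
    obtain ⟨c, hc, hle⟩ := monomial_mem_pow_iff.mp hd
    refine ⟨c, hc, fun i hi => le_trans ?_ (h i hi)⟩
    have := hle i
    rw [Finsupp.finsetSum_apply] at this
    exact_mod_cast this
  · rintro ⟨c, hc, h⟩
    refine ⟨∑ j, c j • e j, monomial_mem_pow_iff.mpr ⟨c, hc, le_rfl⟩, fun i hi => ?_⟩
    have := h i hi
    rw [Finsupp.finsetSum_apply]
    exact_mod_cast this

variable {J : Ideal (MvPolynomial (Fin N) k)}

lemma cochainCoeff_supported (hJ : ∀ f ∈ J, ∀ e, coeff e f ≠ 0 → monomial e 1 ∈ J) {p t : ℤ}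
    {c : Cochain k (N := N) J} (hc : c ∈ cochains k (idealGrading J) p t) (a : Fin N → ℤ)
    {F : Finset (Fin N)} (hF : cochainCoeff J c a F ≠ 0) :
    InLocalization J a F ∧ (F.card : ℤ) = p := by
  refine ⟨inLocalization_of_coeff_ne_zero hJ hF, ?_⟩
  by_contra h
  rw [cochainCoeff, (hc F).2 h] at hF
  simp at hF

/-- A finitely supported family of multigraded cochains comes from a Čech cochain. -/
lemma exists_cochain_of_cochainCoeff {p t : ℤ} (b : (Fin N → ℤ) → Finset (Fin N) → k)
    (hb : ∀ a F, b a F ≠ 0 → InLocalization J a F ∧ (F.card : ℤ) = p)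
    (ht : ∀ a, ∑ i, a i ≠ t → b a = 0) (A : Finset (Fin N → ℤ)) (hA : ∀ a ∉ A, b a = 0) :
    ∃ c ∈ cochains k (idealGrading J) p t, ∀ a, cochainCoeff J c a = b a := by
  have h : ∀ (a : Fin N → ℤ) (F : Finset (Fin N)), ∃ z ∈ locDeg (idealGrading J) F t,
      laurentExpansion J F z = AddMonoidAlgebra.single a (b a F) ∧ (b a F = 0 → z = 0) := by
    intro a F
    by_cases h0 : b a F = 0
    · exact ⟨0, zero_mem _, by simp [h0], fun _ => rfl⟩
    · obtain ⟨z, hz, hz'⟩ := exists_laurentExpansion_eq_single (hb a F h0).1 (b a F)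
      have hat : ∑ i, a i = t := by
        by_contra hne
        exact h0 (by rw [ht a hne]; rfl)
      exact ⟨z, hat ▸ hz, hz', fun h => absurd h h0⟩
  choose z hz hz' hz0 using h
  refine ⟨fun F => ∑ a ∈ A, z a F, fun F => ⟨sum_mem fun a _ => hz a F, fun hF => ?_⟩, ?_⟩
  · refine Finset.sum_eq_zero fun a _ => hz0 a F ?_
    by_contra hne
    exact hF (hb a F hne).2
  · intro a
    funext F
    rw [cochainCoeff, map_sum, AddMonoidAlgebra.coeff_sum, Finsupp.finsetSum_apply]
    simp only [hz', AddMonoidAlgebra.coeff_single]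
    by_cases ha : a ∈ A
    · rw [Finset.sum_eq_single_of_mem a ha]
      · simp
      · intro a' _ hne
        rw [Finsupp.single_eq_of_ne hne.symm]
    · rw [hA a ha, Finset.sum_eq_zero]
      · rfl
      · intro a' ha'
        rw [Finsupp.single_eq_of_ne]
        rintro rfl
        exact ha ha'

/-- The cocycles are coboundaries if this holds in every multidegree. -/
lemma cocycles_le_coboundaries (hJ : ∀ f ∈ J, ∀ e, coeff e f ≠ 0 → monomial e 1 ∈ J) {p t : ℤ}
    (h : ∀ a : Fin N → ℤ, ∑ i, a i = t → ∀ c : Finset (Fin N) → k,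
      (∀ F, c F ≠ 0 → InLocalization J a F ∧ (F.card : ℤ) = p) → coboundaryMap c = 0 →
      ∃ b : Finset (Fin N) → k,
        (∀ F, b F ≠ 0 → InLocalization J a F ∧ (F.card : ℤ) = p - 1) ∧ coboundaryMap b = c) :
    cocycles (N := N) k (idealGrading J) p t ≤ coboundaries (N := N) k (idealGrading J) p t := by
  classical
  rintro c ⟨hc, hdc⟩
  have hdc' : cechD J c = 0 := hdc
  have hcoc : ∀ a, coboundaryMap (cochainCoeff J c a) = 0 := by
    intro a
    rw [← cochainCoeff_cechD, hdc']
    funext F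
    simp [cochainCoeff]
  have hdeg : ∀ a, cochainCoeff J c a ≠ 0 → ∑ i, a i = t := by
    intro a ha
    obtain ⟨F, hF⟩ := Function.ne_iff.mp ha
    exact sum_eq_of_coeff_ne_zero (hc F).1 hF
  -- Choosing `b = 0` wherever the coefficients of `c` vanish keeps the family finitely supported,
  -- as gluing requires.
  have h' : ∀ a, ∃ b : Finset (Fin N) → k,
      (∀ F, b F ≠ 0 → InLocalization J a F ∧ (F.card : ℤ) = p - 1) ∧
      coboundaryMap b = cochainCoeff J c a ∧ (cochainCoeff J c a = 0 → b = 0) := by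
    intro a
    by_cases h0 : cochainCoeff J c a = 0
    · exact ⟨0, by simp, by rw [coboundaryMap_zero, h0], fun _ => rfl⟩
    · obtain ⟨b, hb, hbc⟩ := h a (hdeg a h0) _ (fun F => cochainCoeff_supported hJ hc a) (hcoc a)
      exact ⟨b, hb, hbc, fun h => absurd h h0⟩
  choose b hb hbc hb0 using h'
  obtain ⟨d, hd, hdb⟩ := exists_cochain_of_cochainCoeff (p := p - 1) (t := t) b hb
    (fun a ha => hb0 a (by_contra fun h0 => ha (hdeg a h0)))
    (Finset.univ.biUnion fun F => (laurentExpansion J F (c F)).coeff.support) (fun a ha => by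
      apply hb0
      funext F
      simp only [Finset.mem_biUnion, Finset.mem_univ, true_and, not_exists,
        Finsupp.mem_support_iff, not_not] at ha
      exact ha F)
  refine ⟨d, hd, cochain_ext J fun a => ?_⟩
  change cochainCoeff J (cechD J d) a = _
  rw [cochainCoeff_cechD, hdb, hbc]

/-- A multidegree in which some cocycle is not a coboundary gives nonzero local cohomology. -/
lemma not_cocycles_le_coboundaries (hJ : ∀ f ∈ J, ∀ e, coeff e f ≠ 0 → monomial e 1 ∈ J) {p : ℤ}
    {a : Fin N → ℤ} {c : Finset (Fin N) → k}
    (hc : ∀ F, c F ≠ 0 → InLocalization J a F ∧ (F.card : ℤ) = p) (hdc : coboundaryMap c = 0)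
    (h : ∀ b : Finset (Fin N) → k,
      (∀ F, b F ≠ 0 → InLocalization J a F ∧ (F.card : ℤ) = p - 1) → coboundaryMap b ≠ c) :
    ¬ cocycles (N := N) k (idealGrading J) p (∑ i, a i) ≤ coboundaries (N := N) k (idealGrading J) p (∑ i, a i) := by
  classical
  intro hle
  obtain ⟨d, hd, hdc'⟩ := exists_cochain_of_cochainCoeff (p := p) (t := ∑ i, a i) (J := J)
    (Pi.single a c) (fun a' F hF => by
      by_cases haa : a' = a
      · subst haa
        rw [Pi.single_eq_same] at hF
        exact hc F hF
      · rw [Pi.single_eq_of_ne haa] at hF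
        exact absurd rfl hF)
    (fun a' ha' => Pi.single_eq_of_ne (fun h => ha' (by rw [h])) _) {a}
    (fun a' ha' => Pi.single_eq_of_ne (fun h => ha' (by simp [h])) _)
  have hcoc : cechD J d = 0 := by
    apply cochain_ext
    intro a'
    rw [cochainCoeff_cechD, hdc']
    have h0 : cochainCoeff J 0 a' = (0 : Finset (Fin N) → k) := by
      funext F
      simp [cochainCoeff]
    rw [h0]
    by_cases haa : a' = a
    · subst haa
      rw [Pi.single_eq_same, hdc]
    · rw [Pi.single_eq_of_ne haa, coboundaryMap_zero]
  obtain ⟨b, hb, hbd⟩ := hle ⟨hd, hcoc⟩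
  refine h (cochainCoeff J b a) (fun F => cochainCoeff_supported hJ hb a) ?_
  rw [← cochainCoeff_cechD]
  change cechD J b = d at hbd
  rw [hbd, hdc', Pi.single_eq_same]

lemma reg_eq_of_forall_le_of_nontrivial {M : Type*} [AddCommGroup M]
    [Module (MvPolynomial (Fin N) k) M] (𝓜 : ℤ → AddSubgroup M) {R : ℤ}
    (hle : ∀ (i : ℕ) (t : ℤ), Nontrivial (LocalCohomologyDeg (k := k) (N := N) 𝓜 i t) →
      t + i ≤ R)
    (hex : ∃ (i : ℕ) (t : ℤ), Nontrivial (LocalCohomologyDeg (k := k) (N := N) 𝓜 i t) ∧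
      t + i = R) :
    reg k N 𝓜 = ((R : WithTop ℤ) : WithBot (WithTop ℤ)) := by
  apply le_antisymm
  · refine iSup_le fun i => ?_
    have h : aInv k N 𝓜 i ≤ (((R - i : ℤ) : WithTop ℤ) : WithBot (WithTop ℤ)) := by
      refine sSup_le ?_
      rintro _ ⟨t, ht, rfl⟩
      have := hle i t ht
      exact_mod_cast (by omega : t ≤ R - i)
    refine (add_le_add_left h _).trans ?_
    exact_mod_cast (by omega : R - i + i ≤ R)
  · obtain ⟨i, t, ht, rfl⟩ := hex
    refine le_trans ?_ (le_iSup _ i)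
    have h : ((t : WithTop ℤ) : WithBot (WithTop ℤ)) ≤ aInv k N 𝓜 i := le_sSup ⟨t, ht, rfl⟩
    exact le_trans (by exact_mod_cast le_rfl) (add_le_add_left h _)

/-- The regularity of the powers of an ideal generated by monomials with disjoint supports. -/
lemma idealReg_span_pow {e : Fin s → Fin N →₀ ℕ}
    (hd : ∀ i j, i ≠ j → ∀ x, e i x ≠ 0 → e j x = 0) (he : ∀ j, e j ≠ 0) {n : ℕ} (hn : 1 ≤ n)
    {l : Fin s} (hl : ∀ j, (e j).degree ≤ (e l).degree) :
    idealReg (Ideal.span (Set.range fun j => monomial (e j) (1 : k)) ^ n) =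
      (((n * (e l).degree + ∑ j ∈ Finset.univ.erase l, ((e j).degree : ℤ)
        - ((s : ℤ) - 1) : ℤ) : WithTop ℤ) : WithBot (WithTop ℤ)) := by
  refine reg_eq_of_forall_le_of_nontrivial _ ?_ ?_
  · intro i t ht
    rw [nontrivial_localCohomologyDeg_iff] at ht
    by_contra hlt
    refine ht (cocycles_le_coboundaries (fun f hf d => monomial_mem_of_mem_pow hf) ?_)
    rintro a rfl c hc hdc
    simp only [inLocalization_span_pow_iff] at hc ⊢
    exact exists_coboundaryMap_eq_of_lt hd he hn hl (not_le.mp hlt) hc hdc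
  · obtain ⟨a, ha, c, hc, hdc, hb⟩ := exists_cocycle_not_coboundary k hd he hn l
    have hs := card_le_of_disjoint_support hd he
    -- Disjoint nonempty supports force `s ≤ N`, so the truncated subtraction is exact.
    have hp : ((N - s + 1 : ℕ) : ℤ) = N - s + 1 := by push_cast [Nat.cast_sub hs]; rfl
    refine ⟨N - s + 1, ∑ i, a i, ?_, by rw [hp]; linarith⟩
    rw [nontrivial_localCohomologyDeg_iff, hp]
    refine not_cocycles_le_coboundaries (fun f hf d => monomial_mem_of_mem_pow hf) (c := c)
      ?_ hdc ?_
    · simpa only [inLocalization_span_pow_iff] using hc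
    · simpa only [inLocalization_span_pow_iff, add_sub_cancel_right] using hb

end Regularity

theorem theorem2p1 {k : Type*} [Field k] {N s : ℕ} (hs : 0 < s)
    (I : Ideal (MvPolynomial (Fin N) k)) (hI : CMReg.IsCompleteIntersection I)
    (u : Fin s → MvPolynomial (Fin N) k) (hu : CMReg.IsMinimalMonomialGenerators u I)
    (hdeg : Antitone fun j => (u j).totalDegree) (n : ℕ) (hn : 1 ≤ n) :
    CMReg.idealReg (I ^ n) =
      (((n * (u ⟨0, hs⟩).totalDegree
          + ∑ j ∈ Finset.univ.erase (⟨0, hs⟩ : Fin s), ((u j).totalDegree : ℤ)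
          - ((s : ℤ) - 1) : ℤ) : WithTop ℤ) : WithBot (WithTop ℤ)) := by
  choose e he using hu.monomial
  obtain rfl : u = fun j => MvPolynomial.monomial (e j) 1 := funext he
  have htd : ∀ j, (MvPolynomial.monomial (e j) (1 : k)).totalDegree = (e j).degree := fun j =>
    MvPolynomial.totalDegree_monomial _ one_ne_zero
  simp only [htd] at hdeg ⊢
  have hne : ∀ j, e j ≠ 0 := by
    intro j hj
    apply IsCompleteIntersection.ne_top hI
    rw [← hu.span_eq, Ideal.eq_top_iff_one]
    refine Ideal.subset_span ⟨j, ?_⟩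
    simp only [hj]
    rfl
  rw [← hu.span_eq]
  exact idealReg_span_pow (fun i j hij x => IsCompleteIntersection.disjoint_support hI hu hij x)
    hne hn fun j => hdeg (Fin.mk_le_mk.mpr (Nat.zero_le _))
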